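/- Let $k$ be a commutative ring and let $H$ be a Hopf algebra over $k$ that is projective as a $k$-module and whose antipode $S$ is bijective. Let $A$ be a right $H$-comodule algebra with coaction $a\mapsto a_{[0]}\otimes a_{[1]}$, and let $B=A^{\mathrm{co}H}=\{a\in A : a_{[0]}\otimes a_{[1]}=a\otimes 1\}$. Assume that $A$ is a faithfully flat right $H$-Galois extension of $B$: the canonical map $A\otimes_B A\to A\otimes_k H$, $a\otimes_B a'\mapsto aa'_{[0]}\otimes a'_{[1]}$, is bijective and $A$ is faithfully flat as a left $B$-module. Let $M$ be a right $B$-module. The right $A$-module $M\otimes_B A$ is a right $H$-comodule through $\rho(m\otimes_B a)=(m\otimes_B a_{[0]})\otimes a_{[1]}$. Let $E=\mathrm{END}_A(M\otimes_B A)$ be the algebra of rational endomorphisms, that is, of the right $A$-linear maps $f: M\otimes_B A\to M\otimes_B A$ for which there is an element $f_{[0]}\otimes f_{[1]}$ (summation understood) of $\mathrm{End}_A(M\otimes_B A)\otimes_k H$ with $\rho(f(p))=f_{[0]}(p_{[0]})\otimes f_{[1]}p_{[1]}$ for all $p\in M\otimes_B A$. This element is unique and lies in $E\otimes_k H$, and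 $f\mapsto f_{[0]}\otimes f_{[1]}$ makes $E$ a right $H$-comodule algebra. Then the following are equivalent: 1. $M$ is $H$-stable, that is, there is an isomorphism $M\otimes_k H\cong M\otimes_B A$ that is right $B$-linear and right $H$-colinear, where $(m\otimes h)b=mb\otimes h$ and $(m\otimes_B a)b=m\otimes_B ab$ for $b\in B$, and $M\otimes_k H$ has the coaction $m\otimes h\mapsto (m\otimes h_{(1)})\otimes h_{(2)}$. 2. $E$ is cleft, that is, there is a right $H$-colinear map $t:H\to E$ that is invertible for the convolution product $(t*u)(h)=t(h_{(1)})\circ u(h_{(2)})$ of $\mathrm{Hom}_k(H,E)$. -/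

import Mathlib

open scoped TensorProduct
open MulOpposite

universe u v w x

noncomputable section

namespace HopfGalois

/-! ### Right comodules and comodule algebras over a Hopf algebra -/

/-- A right `H`-coaction on the `k`-module `M`. -/
structure RightCoaction (k H M : Type*) [CommRing k] [Ring H] [HopfAlgebra k H]
    [AddCommGroup M] [Module k M] where
  /-- The coaction `m ↦ m₀ ⊗ m₁`. -/
  coact : M →ₗ[k] M ⊗[k] H
  coassoc : (TensorProduct.assoc k M H H).toLinearMap ∘ₗ coact.rTensor H ∘ₗ coact =
    (Coalgebra.comul (R := k) (A := H)).lTensor M ∘ₗ coact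
  counit : (TensorProduct.rid k M).toLinearMap ∘ₗ
    (Coalgebra.counit (R := k) (A := H)).lTensor M ∘ₗ coact = LinearMap.id

/-- A linear map `f` between right `H`-comodules is colinear: `f(m)₀ ⊗ f(m)₁ = f(m₀) ⊗ m₁`. -/
def IsColinear {k H M N : Type*} [CommRing k] [Ring H] [HopfAlgebra k H]
    [AddCommGroup M] [Module k M] [AddCommGroup N] [Module k N]
    (ρ : RightCoaction k H M) (σ : RightCoaction k H N) (f : M →ₗ[k] N) : Prop :=
  σ.coact ∘ₗ f = f.rTensor H ∘ₗ ρ.coact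

/-- A right `H`-comodule algebra structure on the `k`-algebra `A`: a right coaction that is
an algebra map `A → A ⊗ H`. -/
structure ComoduleAlgebra (k H A : Type*) [CommRing k] [Ring H] [HopfAlgebra k H]
    [Ring A] [Algebra k A] where
  /-- The coaction `a ↦ a₀ ⊗ a₁`. -/
  coact : A →ₐ[k] A ⊗[k] H
  coassoc : (TensorProduct.assoc k A H H).toLinearMap ∘ₗ
      coact.toLinearMap.rTensor H ∘ₗ coact.toLinearMap =
    (Coalgebra.comul (R := k) (A := H)).lTensor A ∘ₗ coact.toLinearMap
  counit : (TensorProduct.rid k A).toLinearMap ∘ₗ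
    (Coalgebra.counit (R := k) (A := H)).lTensor A ∘ₗ coact.toLinearMap = LinearMap.id

/-- The comodule underlying a comodule algebra. -/
def ComoduleAlgebra.toRightCoaction {k H A : Type*} [CommRing k] [Ring H] [HopfAlgebra k H]
    [Ring A] [Algebra k A] (ρ : ComoduleAlgebra k H A) : RightCoaction k H A where
  coact := ρ.coact.toLinearMap
  coassoc := ρ.coassoc
  counit := ρ.counit

/-- The subalgebra of coinvariants `{a | ρ(a) = a ⊗ 1}`. -/
def ComoduleAlgebra.coinvariants {k H A : Type*} [CommRing k] [Ring H] [HopfAlgebra k H]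
    [Ring A] [Algebra k A] (ρ : ComoduleAlgebra k H A) : Subalgebra k A :=
  AlgHom.equalizer ρ.coact (Algebra.TensorProduct.includeLeft : A →ₐ[k] A ⊗[k] H)

/-- The right coaction `M ⊗ Δ` on `M ⊗ H`. -/
def RightCoaction.cofree (k H M : Type*) [CommRing k] [Ring H] [HopfAlgebra k H]
    [AddCommGroup M] [Module k M] : RightCoaction k H (M ⊗[k] H) where
  coact := (TensorProduct.assoc k M H H).symm.toLinearMap ∘ₗ
    (Coalgebra.comul (R := k) (A := H)).lTensor M
  coassoc := by
    ext m h
    have key : ∀ y : H ⊗[k] H,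
        (TensorProduct.assoc k (M ⊗[k] H) H H)
          (LinearMap.rTensor H ((TensorProduct.assoc k M H H).symm.toLinearMap ∘ₗ
            (Coalgebra.comul (R := k) (A := H)).lTensor M)
            ((TensorProduct.assoc k M H H).symm (m ⊗ₜ[k] y))) =
        (TensorProduct.assoc k M H (H ⊗[k] H)).symm
          (m ⊗ₜ (TensorProduct.assoc k H H H
            ((Coalgebra.comul (R := k) (A := H)).rTensor H y))) := by
      intro y
      induction y with
      | zero => simp
      | add a b ha hb => simp only [TensorProduct.tmul_add, map_add, ha, hb]
      | tmul a b =>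
        simp only [TensorProduct.assoc_symm_tmul, LinearMap.rTensor_tmul, LinearMap.comp_apply,
          LinearMap.lTensor_tmul, LinearEquiv.coe_coe]
        generalize Coalgebra.comul (R := k) a = z
        induction z with
        | zero => simp
        | add a b ha hb => simp only [TensorProduct.tmul_add, TensorProduct.add_tmul, map_add, ha, hb]
        | tmul a b => simp
    have key2 : ∀ y : H ⊗[k] H,
        LinearMap.lTensor (M ⊗[k] H) (Coalgebra.comul (R := k) (A := H))
            ((TensorProduct.assoc k M H H).symm (m ⊗ₜ[k] y)) =
        (TensorProduct.assoc k M H (H ⊗[k] H)).symm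
          (m ⊗ₜ ((Coalgebra.comul (R := k) (A := H)).lTensor H y)) := by
      intro y
      induction y with
      | zero => simp
      | add a b ha hb => simp only [TensorProduct.tmul_add, map_add, ha, hb]
      | tmul a b => simp
    have := key (Coalgebra.comul (R := k) h)
    have h2 := key2 (Coalgebra.comul (R := k) h)
    rw [Coalgebra.coassoc_apply] at this
    simpa using this.trans h2.symm
  counit := by
    ext m h
    have key : ∀ y : H ⊗[k] H,
        (TensorProduct.rid k (M ⊗[k] H))
          (LinearMap.lTensor (M ⊗[k] H) (Coalgebra.counit (R := k) (A := H))
            ((TensorProduct.assoc k M H H).symm (m ⊗ₜ[k] y))) =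
        m ⊗ₜ (TensorProduct.rid k H ((Coalgebra.counit (R := k) (A := H)).lTensor H y)) := by
      intro y
      induction y with
      | zero => simp
      | add a b ha hb => simp only [TensorProduct.tmul_add, map_add, ha, hb]
      | tmul a b => simp
    have := key (Coalgebra.comul (R := k) h)
    simpa using this

/-- `H` as a right comodule over itself, through the comultiplication. -/
def RightCoaction.regular (k H : Type*) [CommRing k] [Ring H] [HopfAlgebra k H] :
    RightCoaction k H H where
  coact := Coalgebra.comul
  coassoc := Coalgebra.coassoc
  counit := by ext h; simp

/-- A comodule algebra is cleft if there is a colinear map `t : H → A` that is invertible for the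
convolution product of `Hom(H, A)`. -/
def ComoduleAlgebra.IsCleft {k H A : Type*} [CommRing k] [Ring H] [HopfAlgebra k H]
    [Ring A] [Algebra k A] (ρ : ComoduleAlgebra k H A) : Prop :=
  ∃ t : H →ₗ[k] A, IsColinear (RightCoaction.regular k H) ρ.toRightCoaction t ∧
    IsUnit (WithConv.toConv t)

/-! ### Tensor products over a noncommutative algebra -/

section Balanced

variable (k B M N : Type*) [CommRing k] [Ring B] [AddCommGroup M] [Module k M] [Module Bᵐᵒᵖ M]
  [AddCommGroup N] [Module k N] [Module B N]

/-- The relations `m b ⊗ n = m ⊗ b n`. -/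
def balancedRel : Submodule k (M ⊗[k] N) :=
  Submodule.span k {z | ∃ (m : M) (b : B) (n : N), z = (op b • m) ⊗ₜ n - m ⊗ₜ (b • n)}

/-- `M ⊗_B N` for a right `B`-module `M` and a left `B`-module `N`, where `B` is a `k`-algebra,
as a quotient of `M ⊗_k N`. -/
def BalTensor : Type _ := (M ⊗[k] N) ⧸ balancedRel k B M N

instance : AddCommGroup (BalTensor k B M N) :=
  inferInstanceAs (AddCommGroup ((M ⊗[k] N) ⧸ balancedRel k B M N))

instance : Module k (BalTensor k B M N) :=
  inferInstanceAs (Module k ((M ⊗[k] N) ⧸ balancedRel k B M N))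

namespace BalTensor

/-- The projection `M ⊗_k N → M ⊗_B N`. -/
def proj : M ⊗[k] N →ₗ[k] BalTensor k B M N := (balancedRel k B M N).mkQ

variable {M N}

/-- The element `m ⊗_B n`. -/
def tmul (m : M) (n : N) : BalTensor k B M N := proj k B M N (m ⊗ₜ n)

variable {k B}

theorem proj_surjective : Function.Surjective (proj k B M N) :=
  Submodule.mkQ_surjective _

theorem proj_balanced (m : M) (b : B) (n : N) :
    proj k B M N ((op b • m) ⊗ₜ n) = proj k B M N (m ⊗ₜ (b • n)) :=
  (Submodule.Quotient.eq _).2 (Submodule.subset_span ⟨m, b, n, rfl⟩)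

/-- The universal property of `M ⊗_B N`. -/
def lift {X : Type*} [AddCommGroup X] [Module k X] (f : M ⊗[k] N →ₗ[k] X)
    (hf : ∀ (m : M) (b : B) (n : N), f ((op b • m) ⊗ₜ n) = f (m ⊗ₜ (b • n))) :
    BalTensor k B M N →ₗ[k] X :=
  (balancedRel k B M N).liftQ f (Submodule.span_le.2 (by
    rintro _ ⟨m, b, n, rfl⟩
    simp [hf]))

theorem lift_proj {X : Type*} [AddCommGroup X] [Module k X] (f : M ⊗[k] N →ₗ[k] X)
    (hf : ∀ (m : M) (b : B) (n : N), f ((op b • m) ⊗ₜ n) = f (m ⊗ₜ (b • n))) (z : M ⊗[k] N) :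
    lift f hf (proj k B M N z) = f z := rfl

theorem hom_ext {X : Type*} [AddCommGroup X] [Module k X] {f g : BalTensor k B M N →ₗ[k] X}
    (h : ∀ m n, f (proj k B M N (m ⊗ₜ n)) = g (proj k B M N (m ⊗ₜ n))) : f = g := by
  have : f ∘ₗ proj k B M N = g ∘ₗ proj k B M N := TensorProduct.ext' h
  ext z
  obtain ⟨z, rfl⟩ := proj_surjective z
  exact LinearMap.congr_fun this z

/-- The map `f ⊗_B N : M ⊗_B N → M' ⊗_B N` induced by a right `B`-linear map `f`. -/
def rTensor [Algebra k B] [IsScalarTower k Bᵐᵒᵖ M] {M' : Type*} [AddCommGroup M'] [Module k M']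
    [Module Bᵐᵒᵖ M'] [IsScalarTower k Bᵐᵒᵖ M'] (N : Type*) [AddCommGroup N] [Module k N]
    [Module B N] (f : M →ₗ[Bᵐᵒᵖ] M') :
    BalTensor k B M N →ₗ[k] BalTensor k B M' N :=
  lift (proj k B M' N ∘ₗ (f.restrictScalars k).rTensor N) (fun m b n => by
    simp [proj_balanced])

end BalTensor

end Balanced

/-- The left `B`-module `N` is faithfully flat: a sequence `X → Y → Z` of right `B`-modules is
exact if and only if `X ⊗_B N → Y ⊗_B N → Z ⊗_B N` is exact. The modules range over the
universe `z`; the property does not depend on `z` as long as `z` is at least the universe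
of `B`. Every right `B`-module is a `k`-module through `k → B`, and this is the `k`-module
structure that the compatibility condition singles out. -/
def IsLeftFaithfullyFlat.{z, a, b, c} (k : Type a) (B : Type b) (N : Type c) [CommRing k] [Ring B]
    [Algebra k B] [AddCommGroup N] [Module k N] [Module B N] : Prop :=
  ∀ (X Y Z : Type z) [AddCommGroup X] [Module k X] [Module Bᵐᵒᵖ X] [IsScalarTower k Bᵐᵒᵖ X]
    [AddCommGroup Y] [Module k Y] [Module Bᵐᵒᵖ Y] [IsScalarTower k Bᵐᵒᵖ Y]
    [AddCommGroup Z] [Module k Z] [Module Bᵐᵒᵖ Z] [IsScalarTower k Bᵐᵒᵖ Z]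
    (f : X →ₗ[Bᵐᵒᵖ] Y) (g : Y →ₗ[Bᵐᵒᵖ] Z),
    Function.Exact f g ↔
      Function.Exact (BalTensor.rTensor (k := k) N f) (BalTensor.rTensor (k := k) N g)

/-! ### Hopf-Galois extensions -/

/-- An algebra is a right module over each of its subalgebras, by right multiplication. -/
instance subalgebraRightModule {k A : Type*} [CommRing k] [Ring A] [Algebra k A]
    (S : Subalgebra k A) : Module Sᵐᵒᵖ A :=
  Module.compHom A (RingHom.op S.val.toRingHom)

theorem subalgebra_op_smul {k A : Type*} [CommRing k] [Ring A] [Algebra k A]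
    (S : Subalgebra k A) (b : S) (a : A) : op b • a = a * (b : A) := rfl

section Galois

variable {k H A : Type*} [CommRing k] [Ring H] [HopfAlgebra k H] [Ring A] [Algebra k A]
  (ρ : ComoduleAlgebra k H A)

theorem ComoduleAlgebra.coact_coinvariant (b : ρ.coinvariants) :
    ρ.coact (b : A) = (b : A) ⊗ₜ 1 := b.2

/-- The canonical map `A ⊗_B A → A ⊗ H`, `a ⊗ a' ↦ a a'₀ ⊗ a'₁`. -/
def ComoduleAlgebra.can : BalTensor k ρ.coinvariants A A →ₗ[k] A ⊗[k] H :=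
  BalTensor.lift (LinearMap.mul' k (A ⊗[k] H) ∘ₗ
      TensorProduct.map (Algebra.TensorProduct.includeLeft : A →ₐ[k] A ⊗[k] H).toLinearMap
        ρ.coact.toLinearMap) (fun m b n => by
    simp [subalgebra_op_smul, Subalgebra.smul_def, ρ.coact_coinvariant, ← mul_assoc])

/-- `A` is a faithfully flat right `H`-Galois extension of its coinvariants `B`: the
canonical map is bijective and `A` is faithfully flat as a left `B`-module. -/
def ComoduleAlgebra.IsFaithfullyFlatGalois.{z, a, b, c} {k : Type a} {H : Type b} {A : Type c}
    [CommRing k] [Ring H] [HopfAlgebra k H] [Ring A] [Algebra k A]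
    (ρ : ComoduleAlgebra k H A) : Prop :=
  Function.Bijective ρ.can ∧ IsLeftFaithfullyFlat.{z} k ρ.coinvariants A

end Galois

/-! ### The induced relative Hopf module -/

section Induced

variable {k A : Type*} [CommRing k] [Ring A] [Algebra k A] (S : Subalgebra k A)
  (M : Type*) [AddCommGroup M] [Module k M] [Module Sᵐᵒᵖ M]

/-- Right multiplication by `a` on `M ⊗_S A`. -/
def rightMul (a : A) : BalTensor k S M A →ₗ[k] BalTensor k S M A :=
  BalTensor.lift (BalTensor.proj k S M A ∘ₗ (LinearMap.mulRight k a).lTensor M)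
    (fun m b n => by simp [BalTensor.proj_balanced, Subalgebra.smul_def, mul_assoc])

theorem rightMul_proj (a : A) (m : M) (x : A) :
    rightMul S M a (BalTensor.proj k S M A (m ⊗ₜ x)) =
      BalTensor.proj k S M A (m ⊗ₜ (x * a)) := rfl

/-- The right `A`-module `M ⊗_S A`, with `(m ⊗ x) a = m ⊗ x a`. -/
instance inducedModule : Module Aᵐᵒᵖ (BalTensor k S M A) where
  smul a z := rightMul S M a.unop z
  one_smul z := LinearMap.congr_fun (f := rightMul S M 1) (g := LinearMap.id)
    (BalTensor.hom_ext fun m n => by simp [rightMul_proj]) z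
  mul_smul a b z := LinearMap.congr_fun (f := rightMul S M (a * b).unop)
    (g := rightMul S M a.unop ∘ₗ rightMul S M b.unop)
    (BalTensor.hom_ext fun m n => by simp [rightMul_proj, mul_assoc]) z
  smul_zero a := map_zero _
  smul_add a := map_add _
  add_smul a b z := LinearMap.congr_fun (f := rightMul S M (a + b).unop)
    (g := rightMul S M a.unop + rightMul S M b.unop)
    (BalTensor.hom_ext fun m n => by
      simp [rightMul_proj, mul_add, TensorProduct.tmul_add]) z
  zero_smul z := LinearMap.congr_fun (f := rightMul S M 0) (g := 0)
    (BalTensor.hom_ext fun m n => by simp [rightMul_proj]) z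

theorem induced_smul_proj (a : A) (m : M) (x : A) :
    op a • BalTensor.proj k S M A (m ⊗ₜ x) = BalTensor.proj k S M A (m ⊗ₜ (x * a)) := rfl

instance inducedScalarTower : IsScalarTower k Aᵐᵒᵖ (BalTensor k S M A) where
  smul_assoc c a z := LinearMap.congr_fun (f := rightMul S M (c • a).unop)
    (g := c • rightMul S M a.unop)
    (BalTensor.hom_ext fun m n => by
      simp [rightMul_proj]) z

end Induced

section InducedCoaction

variable {k H A : Type*} [CommRing k] [Ring H] [HopfAlgebra k H] [Ring A] [Algebra k A]
  (ρ : ComoduleAlgebra k H A)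
  (M : Type*) [AddCommGroup M] [Module k M] [Module (ρ.coinvariants)ᵐᵒᵖ M]

/-- The linear map `m ⊗ a ↦ (m ⊗ a₀) ⊗ a₁` underlying the coaction on `M ⊗_B A`. -/
def inducedCoact : BalTensor k ρ.coinvariants M A →ₗ[k]
    BalTensor k ρ.coinvariants M A ⊗[k] H :=
  BalTensor.lift ((BalTensor.proj k ρ.coinvariants M A).rTensor H ∘ₗ
      (TensorProduct.assoc k M A H).symm.toLinearMap ∘ₗ ρ.coact.toLinearMap.lTensor M)
    (fun m b n => by
      simp only [LinearMap.comp_apply, LinearMap.lTensor_tmul, AlgHom.toLinearMap_apply,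
        Subalgebra.smul_def, smul_eq_mul, map_mul, ρ.coact_coinvariant, LinearEquiv.coe_coe]
      generalize ρ.coact n = z
      induction z with
      | zero => simp
      | add a b ha hb => simp only [TensorProduct.tmul_add, mul_add, map_add, ha, hb]
      | tmul x h =>
        simp [BalTensor.proj_balanced, Subalgebra.smul_def])

theorem inducedCoact_proj (m : M) (a : A) :
    inducedCoact ρ M (BalTensor.proj k ρ.coinvariants M A (m ⊗ₜ a)) =
      (BalTensor.proj k ρ.coinvariants M A ∘ₗ TensorProduct.mk k M A m).rTensor H (ρ.coact a) := by
  change (BalTensor.proj k ρ.coinvariants M A).rTensor H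
    ((TensorProduct.assoc k M A H).symm (m ⊗ₜ ρ.coact a)) = _
  generalize ρ.coact a = z
  induction z with
  | zero => simp
  | add a b ha hb => simp only [TensorProduct.tmul_add, map_add, ha, hb]
  | tmul x h => simp

/-- The right coaction `m ⊗ a ↦ (m ⊗ a₀) ⊗ a₁` on `M ⊗_B A`. -/
def RightCoaction.induced : RightCoaction k H (BalTensor k ρ.coinvariants M A) where
  coact := inducedCoact ρ M
  coassoc := by
    refine BalTensor.hom_ext fun m a => ?_
    set q : A →ₗ[k] BalTensor k ρ.coinvariants M A :=
      BalTensor.proj k ρ.coinvariants M A ∘ₗ TensorProduct.mk k M A m with hq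
    have hc : inducedCoact ρ M ∘ₗ q = q.rTensor H ∘ₗ ρ.coact.toLinearMap := by
      ext x
      exact inducedCoact_proj ρ M m x
    have h0 := LinearMap.congr_fun ρ.coassoc a
    simp only [LinearMap.comp_apply, inducedCoact_proj, ← hq] at h0 ⊢
    rw [← LinearMap.rTensor_comp_apply, hc, LinearMap.rTensor_comp_apply]
    have e1 : ∀ y : (A ⊗[k] H) ⊗[k] H,
        (TensorProduct.assoc k (BalTensor k ρ.coinvariants M A) H H).toLinearMap
          (LinearMap.rTensor H (q.rTensor H) y) =
        q.rTensor (H ⊗[k] H) ((TensorProduct.assoc k A H H).toLinearMap y) :=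
      LinearMap.congr_fun (f := (TensorProduct.assoc k (BalTensor k ρ.coinvariants M A) H
        H).toLinearMap ∘ₗ LinearMap.rTensor H (q.rTensor H))
        (g := q.rTensor (H ⊗[k] H) ∘ₗ (TensorProduct.assoc k A H H).toLinearMap)
        (by ext; simp)
    rw [e1]
    erw [h0]
    exact LinearMap.congr_fun (f := q.rTensor (H ⊗[k] H) ∘ₗ LinearMap.lTensor A
        (Coalgebra.comul (R := k) (A := H)))
      (g := LinearMap.lTensor _ (Coalgebra.comul (R := k) (A := H)) ∘ₗ q.rTensor H)
        (by ext; simp) _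
  counit := by
    refine BalTensor.hom_ext fun m a => ?_
    set q : A →ₗ[k] BalTensor k ρ.coinvariants M A :=
      BalTensor.proj k ρ.coinvariants M A ∘ₗ TensorProduct.mk k M A m with hq
    have h0 := LinearMap.congr_fun ρ.counit a
    simp only [LinearMap.comp_apply, inducedCoact_proj, ← hq] at h0 ⊢
    have e := LinearMap.congr_fun (f := (TensorProduct.rid k _).toLinearMap ∘ₗ
        LinearMap.lTensor _ (Coalgebra.counit (R := k) (A := H)) ∘ₗ q.rTensor H)
      (g := q ∘ₗ (TensorProduct.rid k A).toLinearMap ∘ₗ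
        LinearMap.lTensor A (Coalgebra.counit (R := k) (A := H)))
        (by ext; simp) (ρ.coact a)
    refine e.trans ?_
    exact congrArg q h0

/-- The right `B`-module `M` is `H`-stable: there is an isomorphism `M ⊗ H ≅ M ⊗_B A` that is
right `B`-linear, for `(m ⊗ h) b = m b ⊗ h` and `(m ⊗ a) b = m ⊗ a b`, and right `H`-colinear. -/
def IsStable [IsScalarTower k (ρ.coinvariants)ᵐᵒᵖ M] : Prop :=
  ∃ e : (M ⊗[k] H) ≃ₗ[k] BalTensor k ρ.coinvariants M A,
    (∀ (b : ρ.coinvariants) (z : M ⊗[k] H), e (op b • z) = op (b : A) • e z) ∧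
    IsColinear (RightCoaction.cofree k H M) (RightCoaction.induced ρ M) e.toLinearMap

end InducedCoaction

/-! ### The comodule algebra of rational endomorphisms -/

section Coefficients

variable {k H X : Type*} [CommRing k] [AddCommGroup H] [Module k H] [AddCommGroup X] [Module k X]

/-- `X ⊗ c : X ⊗ H → X` for a functional `c` on `H`. -/
def coeff (c : H →ₗ[k] k) : X ⊗[k] H →ₗ[k] X :=
  (TensorProduct.rid k X).toLinearMap ∘ₗ c.lTensor X

theorem coeff_tmul (c : H →ₗ[k] k) (x : X) (h : H) : coeff c (x ⊗ₜ[k] h) = c h • x := by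
  simp [coeff]

/-- A dual basis of a projective module expresses a tensor through its coefficients. -/
theorem exists_finsupp_coeff (X : Type*) [AddCommGroup X] [Module k X] [Module.Projective k H]
    (z : X ⊗[k] H) : ∃ (c : H → (H →ₗ[k] k)) (f : H →₀ X), (∀ j, f j = coeff (c j) z) ∧
      z = f.sum fun h x => x ⊗ₜ[k] h := by
  classical
  obtain ⟨s, hs⟩ := Module.projective_def.1 (inferInstance : Module.Projective k H)
  refine ⟨fun j => Finsupp.lapply j ∘ₗ s,
    TensorProduct.finsuppScalarRight k k X H (s.lTensor X z), fun j => ?_, ?_⟩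
  · induction z with
    | zero => simp
    | add a b ha hb => simp only [map_add, Finsupp.add_apply, ha, hb]
    | tmul x h => simp [coeff_tmul]
  · have : ∀ f : H →₀ X, (f.sum fun h x => x ⊗ₜ[k] h) =
        Finsupp.lsum k (fun h => (TensorProduct.mk k X H).flip h) f := fun f => rfl
    rw [this]
    induction z with
    | zero => simp
    | add a b ha hb =>
      simp only [map_add]
      rw [← ha, ← hb]
    | tmul x h =>
      conv_lhs => rw [← hs h]
      simp only [LinearMap.lTensor_tmul]
      generalize s h = g
      induction g using Finsupp.induction_linear with
      | zero => simp
      | add a b ha hb => simp only [map_add, TensorProduct.tmul_add, ha, hb]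
      | single a r =>
        rw [TensorProduct.finsuppScalarRight_apply_tmul, Finsupp.sum_single_index (by simp),
          Finsupp.lsum_single, Finsupp.linearCombination_single]
        simp

theorem coeff_rTensor {Y : Type*} [AddCommGroup Y] [Module k Y] (c : H →ₗ[k] k) (g : X →ₗ[k] Y)
    (z : X ⊗[k] H) : coeff c (g.rTensor H z) = g (coeff c z) :=
  LinearMap.congr_fun (f := coeff c ∘ₗ g.rTensor H) (g := g ∘ₗ coeff c)
    (by ext; simp [coeff_tmul]) z

theorem eq_of_coeff_eq [Module.Projective k H] {y z : X ⊗[k] H}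
    (h : ∀ c : H →ₗ[k] k, coeff c y = coeff c z) : y = z := by
  rw [← sub_eq_zero]
  obtain ⟨c, f, hf, hz⟩ := exists_finsupp_coeff X (y - z)
  have : f = 0 := by
    ext j
    rw [hf, map_sub, h, sub_self, Finsupp.zero_apply]
  rw [hz, this, Finsupp.sum_zero_index]

end Coefficients

section EndRational

variable {k H A P : Type*} [CommRing k] [Ring H] [HopfAlgebra k H] [Ring A] [Algebra k A]
  [AddCommGroup P] [Module k P] [Module Aᵐᵒᵖ P] [IsScalarTower k Aᵐᵒᵖ P]
  (δ : RightCoaction k H P)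

/-- For `ξ = f₀ ⊗ f₁` in `End_A(P) ⊗ H`, the map `p ⊗ x ↦ f₀(p) ⊗ f₁ x` on `P ⊗ H`. -/
def tensorAct : Module.End Aᵐᵒᵖ P ⊗[k] H →ₗ[k] (P ⊗[k] H →ₗ[k] P ⊗[k] H) :=
  TensorProduct.homTensorHomMap (RingHom.id k) P H P H ∘ₗ
    TensorProduct.map (LinearMap.restrictScalarsₗ k Aᵐᵒᵖ P P k) (LinearMap.mul k H)

theorem tensorAct_tmul (f : Module.End Aᵐᵒᵖ P) (h : H) :
    tensorAct (f ⊗ₜ[k] h) = TensorProduct.map (f.restrictScalars k) (LinearMap.mulLeft k h) := rfl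

/-- `ξ = f₀ ⊗ f₁` in `End_A(P) ⊗ H` is a coaction value of the right `A`-linear map `f`:
`ρ(f(p)) = f₀(p₀) ⊗ f₁ p₁` for all `p`. -/
def IsCoactionValue (f : Module.End Aᵐᵒᵖ P) (ξ : Module.End Aᵐᵒᵖ P ⊗[k] H) : Prop :=
  ∀ p : P, δ.coact (f p) = tensorAct ξ (δ.coact p)

theorem tensorAct_one : tensorAct (1 : Module.End Aᵐᵒᵖ P ⊗[k] H) = LinearMap.id := by
  rw [Algebra.TensorProduct.one_def, tensorAct_tmul]
  ext; simp

theorem tensorAct_mul (ξ η : Module.End Aᵐᵒᵖ P ⊗[k] H) :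
    tensorAct (ξ * η) = tensorAct ξ ∘ₗ tensorAct η := by
  induction ξ with
  | zero => simp
  | add a b ha hb => simp only [add_mul, map_add, ha, hb, LinearMap.add_comp]
  | tmul f h =>
    induction η with
    | zero => simp
    | add a b ha hb => simp only [mul_add, map_add, ha, hb, LinearMap.comp_add]
    | tmul g l =>
      rw [Algebra.TensorProduct.tmul_mul_tmul]
      simp only [tensorAct_tmul]
      ext; simp

/-- The algebra `END_A(P)` of rational endomorphisms: the right `A`-linear maps `f : P → P` for
which there is `f₀ ⊗ f₁` in `End_A(P) ⊗ H` with `ρ(f(p)) = f₀(p₀) ⊗ f₁ p₁` for all `p`. -/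
def rationalEnd : Subalgebra k (Module.End Aᵐᵒᵖ P) where
  carrier := {f | ∃ ξ, IsCoactionValue δ f ξ}
  mul_mem' := by
    rintro f g ⟨ξ, hξ⟩ ⟨η, hη⟩
    exact ⟨ξ * η, fun p => by
      rw [tensorAct_mul, LinearMap.comp_apply, ← hη, ← hξ, Module.End.mul_apply]⟩
  add_mem' := by
    rintro f g ⟨ξ, hξ⟩ ⟨η, hη⟩
    exact ⟨ξ + η, fun p => by
      rw [map_add, LinearMap.add_apply, LinearMap.add_apply, map_add, hξ, hη]⟩
  algebraMap_mem' := fun r => ⟨r • 1, fun p => by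
    rw [map_smul, tensorAct_one]
    simp [Module.algebraMap_end_apply]⟩

/-- `(x ⊗ a) ⊗ b ↦ x ⊗ a S(b)`. -/
def antipodeContract (k H X : Type*) [CommRing k] [Ring H] [HopfAlgebra k H] [AddCommGroup X]
    [Module k X] : (X ⊗[k] H) ⊗[k] H →ₗ[k] X ⊗[k] H :=
  (LinearMap.mul' k H ∘ₗ (HopfAlgebra.antipode k (A := H)).lTensor H).lTensor X ∘ₗ
    (TensorProduct.assoc k X H H).toLinearMap

theorem antipodeContract_tmul {X : Type*} [AddCommGroup X] [Module k X] (x : X) (a b : H) :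
    antipodeContract k H X ((x ⊗ₜ a) ⊗ₜ b) = x ⊗ₜ (a * HopfAlgebra.antipode k b) := by
  simp [antipodeContract]

theorem antipodeContract_coact (p : P) :
    antipodeContract k H P (δ.coact.rTensor H (δ.coact p)) = p ⊗ₜ 1 := by
  have h := LinearMap.congr_fun δ.coassoc p
  simp only [LinearMap.comp_apply, LinearEquiv.coe_coe] at h
  rw [antipodeContract, LinearMap.comp_apply, LinearEquiv.coe_coe, h,
    ← LinearMap.lTensor_comp_apply, LinearMap.comp_assoc,
    HopfAlgebra.mul_antipode_lTensor_comul]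
  have h2 := LinearMap.congr_fun δ.counit p
  simp only [LinearMap.comp_apply, LinearEquiv.coe_coe, LinearMap.id_apply] at h2
  have e := LinearMap.congr_fun (f := (Algebra.linearMap k H ∘ₗ
      Coalgebra.counit (R := k) (A := H)).lTensor P)
    (g := (TensorProduct.mk k P H).flip 1 ∘ₗ (TensorProduct.rid k P).toLinearMap ∘ₗ
      (Coalgebra.counit (R := k) (A := H)).lTensor P)
    (by ext x h; simp [Algebra.algebraMap_eq_smul_one, TensorProduct.smul_tmul']) (δ.coact p)
  rw [e]
  simp [h2]

/-- For `ξ = f₀ ⊗ f₁`, the map `p ↦ f₀(p) ⊗ f₁`. -/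
def tensorEval (p : P) : Module.End Aᵐᵒᵖ P ⊗[k] H →ₗ[k] P ⊗[k] H :=
  (LinearMap.applyₗ p ∘ₗ LinearMap.restrictScalarsₗ k Aᵐᵒᵖ P P k).rTensor H

theorem tensorEval_tmul (p : P) (f : Module.End Aᵐᵒᵖ P) (h : H) :
    tensorEval p (f ⊗ₜ[k] h) = f p ⊗ₜ h := by
  simp [tensorEval]

theorem antipodeContract_natural {X Y : Type*} [AddCommGroup X] [Module k X] [AddCommGroup Y]
    [Module k Y] (g : X →ₗ[k] Y) (h : H) (z : (X ⊗[k] H) ⊗[k] H) :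
    antipodeContract k H Y
        ((TensorProduct.map g (LinearMap.mulLeft k h)).rTensor H z) =
      TensorProduct.map g (LinearMap.mulLeft k h) (antipodeContract k H X z) :=
  LinearMap.congr_fun (f := antipodeContract k H Y ∘ₗ
      (TensorProduct.map g (LinearMap.mulLeft k h)).rTensor H)
    (g := TensorProduct.map g (LinearMap.mulLeft k h) ∘ₗ antipodeContract k H X)
    (by ext; simp [antipodeContract_tmul, mul_assoc]) z

theorem tensorEval_eq (ξ : Module.End Aᵐᵒᵖ P ⊗[k] H) (p : P) :
    tensorEval p ξ = antipodeContract k H P ((tensorAct ξ ∘ₗ δ.coact).rTensor H (δ.coact p)) := by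
  induction ξ with
  | zero => simp
  | add a b ha hb =>
    simp only [map_add, ha, hb, LinearMap.add_comp, LinearMap.rTensor_add, LinearMap.add_apply]
  | tmul f h =>
    rw [LinearMap.rTensor_comp_apply, tensorAct_tmul, antipodeContract_natural,
      antipodeContract_coact, tensorEval_tmul]
    simp

theorem coeff_apply (c : H →ₗ[k] k) (ξ : Module.End Aᵐᵒᵖ P ⊗[k] H) (p : P) :
    coeff c ξ p = coeff c (tensorEval p ξ) := by
  induction ξ with
  | zero => simp
  | add a b ha hb => simp only [map_add, LinearMap.add_apply, ha, hb]
  | tmul f h => simp [coeff_tmul, tensorEval_tmul]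

/-- Coaction values are unique. -/
theorem IsCoactionValue.unique [Module.Projective k H] {f : Module.End Aᵐᵒᵖ P}
    {ξ η : Module.End Aᵐᵒᵖ P ⊗[k] H} (hξ : IsCoactionValue δ f ξ) (hη : IsCoactionValue δ f η) :
    ξ = η := by
  have h : tensorAct ξ ∘ₗ δ.coact = tensorAct η ∘ₗ δ.coact := by
    ext p
    exact (hξ p).symm.trans (hη p)
  refine eq_of_coeff_eq fun c => ?_
  ext p
  rw [coeff_apply, coeff_apply, tensorEval_eq δ, tensorEval_eq δ, h]

/-- `x ⊗ h ↦ (x ⊗ h₁) ⊗ h₂`. -/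
def comulRight (k H X : Type*) [CommRing k] [Ring H] [HopfAlgebra k H] [AddCommGroup X]
    [Module k X] : X ⊗[k] H →ₗ[k] (X ⊗[k] H) ⊗[k] H :=
  (RightCoaction.cofree k H X).coact

theorem comulRight_rTensor {X Y : Type*} [AddCommGroup X] [Module k X] [AddCommGroup Y]
    [Module k Y] (g : X →ₗ[k] Y) (z : X ⊗[k] H) :
    comulRight k H Y (g.rTensor H z) = (g.rTensor H).rTensor H (comulRight k H X z) := by
  induction z with
  | zero => simp
  | add a b ha hb => simp only [map_add, ha, hb]
  | tmul x h =>
    simp only [comulRight, RightCoaction.cofree, LinearMap.comp_apply, LinearMap.rTensor_tmul,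
      LinearMap.lTensor_tmul, LinearEquiv.coe_coe]
    generalize Coalgebra.comul (R := k) h = y
    induction y with
    | zero => simp
    | add a b ha hb => simp only [TensorProduct.tmul_add, map_add, ha, hb]
    | tmul a b => simp

theorem comulRight_coact (p : P) :
    comulRight k H P (δ.coact p) = δ.coact.rTensor H (δ.coact p) := by
  have h := LinearMap.congr_fun δ.coassoc p
  simp only [LinearMap.comp_apply, LinearEquiv.coe_coe] at h
  simp only [comulRight, RightCoaction.cofree, LinearMap.comp_apply, LinearEquiv.coe_coe]
  rw [← h, LinearEquiv.symm_apply_apply]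

theorem comulRight_map (g : P →ₗ[k] P) {ι : Type*} (h : H) (r : Coalgebra.Repr k h ι) (z : P ⊗[k] H) :
    comulRight k H P (TensorProduct.map g (LinearMap.mulLeft k h) z) =
      ∑ i ∈ r.index, TensorProduct.map (TensorProduct.map g (LinearMap.mulLeft k (r.left i)))
        (LinearMap.mulLeft k (r.right i)) (comulRight k H P z) := by
  induction z with
  | zero => simp
  | add a b ha hb => simp only [map_add, ha, hb, Finset.sum_add_distrib]
  | tmul p x =>
    simp only [comulRight, RightCoaction.cofree, LinearMap.comp_apply, TensorProduct.map_tmul,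
      LinearMap.lTensor_tmul, LinearMap.mulLeft_apply, Bialgebra.comul_mul, LinearEquiv.coe_coe]
    rw [← r.eq]
    generalize Coalgebra.comul (R := k) x = y
    induction y with
    | zero => simp
    | add a b ha hb =>
      simp only [mul_add, TensorProduct.tmul_add, map_add, ha, hb, Finset.sum_add_distrib]
    | tmul a b =>
      simp [Finset.sum_mul, TensorProduct.tmul_sum]

theorem coact_tensorEval {f : Module.End Aᵐᵒᵖ P} {ξ : Module.End Aᵐᵒᵖ P ⊗[k] H}
    (hξ : IsCoactionValue δ f ξ) (c : H →ₗ[k] k) :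
    IsCoactionValue δ (coeff c ξ) (coeff c (comulRight k H _ ξ)) := by
  intro p
  have hf : δ.coact ∘ₗ f.restrictScalars k = tensorAct ξ ∘ₗ δ.coact := by
    ext p
    exact hξ p
  have hN : δ.coact.rTensor H (tensorEval p ξ) =
      antipodeContract k H (P ⊗[k] H)
        ((comulRight k H P ∘ₗ tensorAct ξ ∘ₗ δ.coact).rTensor H (δ.coact p)) := by
    have nat := LinearMap.congr_fun (f := δ.coact.rTensor H ∘ₗ antipodeContract k H P)
      (g := antipodeContract k H (P ⊗[k] H) ∘ₗ (δ.coact.rTensor H).rTensor H)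
      (by ext; simp [antipodeContract_tmul])
    have hcc : comulRight k H P ∘ₗ δ.coact = δ.coact.rTensor H ∘ₗ δ.coact := by
      ext p
      exact comulRight_coact δ p
    rw [tensorEval_eq δ]
    refine (nat _).trans ?_
    rw [LinearMap.comp_apply, ← hf, ← LinearMap.rTensor_comp_apply, ← LinearMap.comp_assoc,
      ← LinearMap.comp_assoc, hcc]
  have hM : ∀ η : Module.End Aᵐᵒᵖ P ⊗[k] H,
      coeff c (antipodeContract k H (P ⊗[k] H)
        ((comulRight k H P ∘ₗ tensorAct η ∘ₗ δ.coact).rTensor H (δ.coact p))) =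
      tensorAct (coeff c (comulRight k H _ η)) (δ.coact p) := by
    intro η
    induction η with
    | zero => simp
    | add a b ha hb =>
      simp only [map_add, LinearMap.add_comp, LinearMap.comp_add, LinearMap.rTensor_add,
        LinearMap.add_apply, ha, hb]
    | tmul g h =>
      let r := Coalgebra.Repr.arbitrary k h
      have e1 : comulRight k H P ∘ₗ tensorAct (g ⊗ₜ[k] h) ∘ₗ δ.coact =
          (∑ i ∈ r.index, TensorProduct.map (TensorProduct.map (g.restrictScalars k)
            (LinearMap.mulLeft k (r.left i))) (LinearMap.mulLeft k (r.right i))) ∘ₗ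
            (δ.coact.rTensor H ∘ₗ δ.coact) := by
        ext q
        simp only [LinearMap.comp_apply, tensorAct_tmul, LinearMap.sum_apply]
        rw [comulRight_map _ _ r, comulRight_coact]
      have e2 : comulRight k H (Module.End Aᵐᵒᵖ P) (g ⊗ₜ[k] h) =
          ∑ i ∈ r.index, (g ⊗ₜ r.left i) ⊗ₜ r.right i := by
        simp only [comulRight, RightCoaction.cofree, LinearMap.comp_apply,
          LinearMap.lTensor_tmul, LinearEquiv.coe_coe]
        rw [← r.eq]
        simp [TensorProduct.tmul_sum]
      have e3 : antipodeContract k H (P ⊗[k] H)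
          ((δ.coact.rTensor H ∘ₗ δ.coact).rTensor H (δ.coact p)) = δ.coact p ⊗ₜ 1 := by
        have nat := LinearMap.congr_fun (f := δ.coact.rTensor H ∘ₗ antipodeContract k H P)
          (g := antipodeContract k H (P ⊗[k] H) ∘ₗ (δ.coact.rTensor H).rTensor H)
          (by ext; simp [antipodeContract_tmul])
        rw [LinearMap.rTensor_comp_apply]
        refine (nat _).symm.trans ?_
        rw [LinearMap.comp_apply, antipodeContract_coact, LinearMap.rTensor_tmul]
      have e4 : ∀ z : ((P ⊗[k] H) ⊗[k] H) ⊗[k] H,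
          antipodeContract k H (P ⊗[k] H) ((∑ i ∈ r.index, TensorProduct.map
            (TensorProduct.map (g.restrictScalars k)
            (LinearMap.mulLeft k (r.left i))) (LinearMap.mulLeft k (r.right i))).rTensor H z) =
          ∑ i ∈ r.index, TensorProduct.map
            (TensorProduct.map (g.restrictScalars k)
            (LinearMap.mulLeft k (r.left i))) (LinearMap.mulLeft k (r.right i))
              (antipodeContract k H (P ⊗[k] H) z) := by
        intro z
        rw [← LinearMap.coe_rTensorHom, map_sum, LinearMap.sum_apply, map_sum]
        exact Finset.sum_congr rfl fun i _ => antipodeContract_natural _ _ _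
      rw [e1, LinearMap.rTensor_comp_apply, e4, e3, e2]
      simp [coeff_tmul, tensorAct_tmul]
  rw [coeff_apply, ← hM, ← hN]
  exact LinearMap.congr_fun (f := δ.coact ∘ₗ coeff c) (g := coeff c ∘ₗ δ.coact.rTensor H)
    (by ext; simp [coeff_tmul]) _

/-! The coaction is constructed for an algebra `E` with an embedding `i : E → End_A(P)` whose
image consists of the rational endomorphisms; this is then applied to `E = END_A(P)`. -/

section Embedding

variable {E : Type*} [Ring E] [Algebra k E] (i : E →ₐ[k] Module.End Aᵐᵒᵖ P)

/-- The map `i ⊗ H : E ⊗ H → End_A(P) ⊗ H`. -/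
def rationalIncl : E ⊗[k] H →ₐ[k] Module.End Aᵐᵒᵖ P ⊗[k] H :=
  Algebra.TensorProduct.map i (AlgHom.id k H)

theorem rationalIncl_eq (ξ : E ⊗[k] H) :
    rationalIncl i ξ = i.toLinearMap.rTensor H ξ := rfl

theorem rationalIncl_coeff (c : H →ₗ[k] k) (ξ : E ⊗[k] H) :
    i (coeff c ξ) = coeff c (rationalIncl i ξ) :=
  (coeff_rTensor c i.toLinearMap ξ).symm

theorem rationalIncl_injective [Module.Projective k H] (hi : Function.Injective i) :
    Function.Injective (rationalIncl (H := H) i) := by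
  intro ξ η h
  refine eq_of_coeff_eq fun c => hi ?_
  rw [rationalIncl_coeff, rationalIncl_coeff, h]

theorem exists_rational_value [Module.Projective k H] (hE : i.range = rationalEnd δ) (f : E) :
    ∃ ξ : E ⊗[k] H, IsCoactionValue δ (i f) (rationalIncl i ξ) := by
  have hf : i f ∈ rationalEnd δ := hE ▸ ⟨f, rfl⟩
  obtain ⟨ξ, hξ⟩ := hf
  obtain ⟨c, g, hg, hs⟩ := exists_finsupp_coeff _ ξ
  have hm : ∀ j, ∃ e, i e = g j := fun j => by
    have : g j ∈ rationalEnd δ := by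
      rw [hg]
      exact ⟨_, coact_tensorEval δ hξ (c j)⟩
    rw [← hE] at this
    exact this
  choose e he using hm
  refine ⟨∑ j ∈ g.support, e j ⊗ₜ j, ?_⟩
  have : rationalIncl i (∑ j ∈ g.support, e j ⊗ₜ[k] j) = ξ := by
    rw [map_sum, hs]
    simp [rationalIncl, Finsupp.sum, he]
  rwa [this]

/-- The coaction value of `f`: the unique `f₀ ⊗ f₁` in `E ⊗ H` with
`ρ(f(p)) = f₀(p₀) ⊗ f₁ p₁` for all `p`. -/
def rationalCoact [Module.Projective k H] (hE : i.range = rationalEnd δ) (f : E) : E ⊗[k] H :=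
  (exists_rational_value δ i hE f).choose

theorem rationalCoact_spec [Module.Projective k H] (hE : i.range = rationalEnd δ) (f : E) :
    IsCoactionValue δ (i f) (rationalIncl i (rationalCoact δ i hE f)) :=
  (exists_rational_value δ i hE f).choose_spec

theorem rationalCoact_eq [Module.Projective k H] (hi : Function.Injective i)
    (hE : i.range = rationalEnd δ) {f : E} {ξ : E ⊗[k] H}
    (h : IsCoactionValue δ (i f) (rationalIncl i ξ)) : rationalCoact δ i hE f = ξ :=
  rationalIncl_injective i hi ((rationalCoact_spec δ i hE f).unique δ h)

/-- The coaction of `E` is an algebra map. -/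
def rationalCoactHom [Module.Projective k H] (hi : Function.Injective i)
    (hE : i.range = rationalEnd δ) : E →ₐ[k] E ⊗[k] H :=
  AlgHom.ofLinearMap
    { toFun := rationalCoact δ i hE
      map_add' := fun f g => rationalCoact_eq δ i hi hE fun p => by
        rw [map_add, map_add, map_add, LinearMap.add_apply, LinearMap.add_apply,
          ← rationalCoact_spec δ i hE f p, ← rationalCoact_spec δ i hE g p, ← map_add]
      map_smul' := fun r f => rationalCoact_eq δ i hi hE fun p => by
        simp only [RingHom.id_apply, map_smul, LinearMap.smul_apply]
        rw [← rationalCoact_spec δ i hE f p] }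
    (rationalCoact_eq δ i hi hE fun p => by rw [map_one, map_one, tensorAct_one]; rfl)
    (fun f g => rationalCoact_eq δ i hi hE fun p => by
      change _ = tensorAct (rationalIncl i (rationalCoact δ i hE f * rationalCoact δ i hE g)) _
      rw [map_mul, map_mul, tensorAct_mul, LinearMap.comp_apply,
        ← rationalCoact_spec δ i hE g p, ← rationalCoact_spec δ i hE f]
      rfl)

theorem coeff_rationalCoact [Module.Projective k H] (hi : Function.Injective i)
    (hE : i.range = rationalEnd δ) (c : H →ₗ[k] k) (f : E) :
    rationalCoact δ i hE (coeff c (rationalCoact δ i hE f)) =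
      coeff c (comulRight k H _ (rationalCoact δ i hE f)) := by
  refine rationalCoact_eq δ i hi hE ?_
  rw [rationalIncl_coeff]
  convert coact_tensorEval δ (rationalCoact_spec δ i hE f) c using 1
  rw [rationalIncl_eq, rationalIncl_eq, comulRight_rTensor, coeff_rTensor]

/-- The comodule algebra structure of `E`. -/
def rationalComoduleAlgebra [Module.Projective k H] (hi : Function.Injective i)
    (hE : i.range = rationalEnd δ) : ComoduleAlgebra k H E where
  coact := rationalCoactHom δ i hi hE
  coassoc := by
    ext1 f
    apply (TensorProduct.assoc k _ H H).symm.injective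
    simp only [LinearMap.comp_apply, LinearEquiv.coe_coe, LinearEquiv.symm_apply_apply]
    refine eq_of_coeff_eq fun c => ?_
    refine Eq.trans ?_ (coeff_rationalCoact δ i hi hE c f)
    exact coeff_rTensor c (rationalCoactHom δ i hi hE).toLinearMap (rationalCoact δ i hE f)
  counit := by
    ext1 f
    change coeff Coalgebra.counit (rationalCoact δ i hE f) = f
    refine hi (LinearMap.ext fun p => ?_)
    rw [rationalIncl_coeff]
    have cp : ∀ q, coeff Coalgebra.counit (δ.coact q) = q := LinearMap.congr_fun δ.counit
    have h := rationalCoact_spec δ i hE f p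
    have e : ∀ ξ : Module.End Aᵐᵒᵖ P ⊗[k] H, ∀ z : P ⊗[k] H,
        coeff Coalgebra.counit (tensorAct ξ z) =
          coeff Coalgebra.counit ξ (coeff (Coalgebra.counit (R := k) (A := H)) z) := by
      intro ξ z
      induction ξ with
      | zero => simp
      | add a b ha hb => simp only [map_add, LinearMap.add_apply, ha, hb]
      | tmul f h =>
        induction z with
        | zero => simp
        | add a b ha hb => simp only [map_add, ha, hb]
        | tmul q x =>
          have hs : ∀ r : k, f (r • q) = r • f q := fun r => (f.restrictScalars k).map_smul r q
          simp [coeff_tmul, tensorAct_tmul, mul_smul, hs]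
    have h2 := congrArg (coeff Coalgebra.counit) h
    rw [e, cp, cp] at h2
    exact h2.symm

end Embedding

/-- The right `H`-comodule algebra `END_A(P)`, for `H` projective over `k`: the coaction sends a
rational `f` to the unique `f₀ ⊗ f₁` in `END_A(P) ⊗ H` with `ρ(f(p)) = f₀(p₀) ⊗ f₁ p₁`. -/
def endComoduleAlgebra (A : Type*) [Ring A] [Algebra k A] [Module Aᵐᵒᵖ P]
    [IsScalarTower k Aᵐᵒᵖ P] [Module.Projective k H] (δ : RightCoaction k H P) :
    ComoduleAlgebra k H (rationalEnd (A := A) δ) :=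
  rationalComoduleAlgebra δ (rationalEnd δ).val Subtype.val_injective
    (Subalgebra.range_val (rationalEnd δ))

end EndRational

end HopfGalois

end

noncomputable section

namespace HopfGalois

section Antipode

open WithConv

variable {k H : Type*} [CommRing k] [Ring H] [HopfAlgebra k H]

theorem algHom_comp_convMul_eq_one {C D : Type*} [Ring C] [Algebra k C] [Ring D] [Algebra k D]
    (f : C →ₐ[k] D) {a b : H →ₗ[k] C} (hab : toConv a * toConv b = 1) :
    toConv (f.toLinearMap ∘ₗ a) * toConv (f.toLinearMap ∘ₗ b) = 1 := by
  have h := LinearMap.algHom_comp_convMul_distrib f (toConv a) (toConv b)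
  rw [hab] at h
  refine (WithConv.ofConv_injective h).symm.trans ?_
  ext h
  exact f.commutes _

/-- The coaction of the convolution inverse of a colinear map is `h ↦ u(h₂) ⊗ S(h₁)`. -/
theorem coact_convInverse {E : Type*} [Ring E] [Algebra k E] (γ : ComoduleAlgebra k H E)
    {t u : H →ₗ[k] E} (ht : IsColinear (RightCoaction.regular k H) γ.toRightCoaction t)
    (htu : toConv t * toConv u = 1) (hut : toConv u * toConv t = 1) :
    toConv (γ.coact.toLinearMap ∘ₗ u) =
      toConv ((Algebra.TensorProduct.includeRight : H →ₐ[k] E ⊗[k] H).toLinearMap ∘ₗ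
        HopfAlgebra.antipode k) *
      toConv ((Algebra.TensorProduct.includeLeft : E →ₐ[k] E ⊗[k] H).toLinearMap ∘ₗ u) := by
  set ιH : H →ₐ[k] E ⊗[k] H := Algebra.TensorProduct.includeRight with hιH
  set ιE : E →ₐ[k] E ⊗[k] H := Algebra.TensorProduct.includeLeft with hιE
  have hsplit : toConv (γ.coact.toLinearMap ∘ₗ t) =
      toConv (ιE.toLinearMap ∘ₗ t) * toConv ιH.toLinearMap := by
    ext h
    have h1 : γ.coact (t h) = t.rTensor H (Coalgebra.comul h) := LinearMap.congr_fun ht h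
    change γ.coact (t h) = LinearMap.mul' k _ (TensorProduct.map _ _ (Coalgebra.comul h))
    rw [h1]
    generalize (Coalgebra.comul h : H ⊗[k] H) = z
    induction z with
    | zero => simp
    | add a b ha hb => simp only [map_add, ha, hb]
    | tmul a b => simp [ιE, ιH]
  have hρ := algHom_comp_convMul_eq_one γ.coact htu
  have hleft : (toConv (ιH.toLinearMap ∘ₗ HopfAlgebra.antipode k) *
      toConv (ιE.toLinearMap ∘ₗ u)) * toConv (γ.coact.toLinearMap ∘ₗ t) = 1 := by
    rw [hsplit]
    have h1 := algHom_comp_convMul_eq_one ιE hut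
    have h2 := algHom_comp_convMul_eq_one ιH (LinearMap.antipode_mul_id (R := k) (C := H))
    revert h1 h2
    generalize toConv (ιE.toLinearMap ∘ₗ u) = b
    generalize toConv (ιE.toLinearMap ∘ₗ t) = c
    generalize toConv (ιH.toLinearMap ∘ₗ HopfAlgebra.antipode k) = a
    intro h1 h2
    rw [mul_assoc, ← mul_assoc b c, h1, one_mul]
    exact h2
  exact (left_inv_eq_right_inv hleft hρ).symm

variable (k H) in
/-- `H` as a comodule algebra over itself. -/
def regularComoduleAlgebra : ComoduleAlgebra k H H where
  coact := Bialgebra.comulAlgHom k H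
  coassoc := (RightCoaction.regular k H).coassoc
  counit := (RightCoaction.regular k H).counit

theorem comul_antipode (h : H) :
    Coalgebra.comul (R := k) (HopfAlgebra.antipode k h) =
      TensorProduct.map (HopfAlgebra.antipode k) (HopfAlgebra.antipode k)
        (TensorProduct.comm k H H (Coalgebra.comul h)) := by
  have hid : IsColinear (RightCoaction.regular k H) (regularComoduleAlgebra k H).toRightCoaction
      (LinearMap.id : H →ₗ[k] H) := by
    ext h
    simp [RightCoaction.regular, regularComoduleAlgebra, ComoduleAlgebra.toRightCoaction]
  have h1 := coact_convInverse (regularComoduleAlgebra k H) hid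
    LinearMap.id_mul_antipode LinearMap.antipode_mul_id
  have h2 : Coalgebra.comul (R := k) (HopfAlgebra.antipode k h) =
      LinearMap.mul' k _ (TensorProduct.map
        ((Algebra.TensorProduct.includeRight : H →ₐ[k] H ⊗[k] H).toLinearMap ∘ₗ
          HopfAlgebra.antipode k)
        ((Algebra.TensorProduct.includeLeft : H →ₐ[k] H ⊗[k] H).toLinearMap ∘ₗ
          HopfAlgebra.antipode k) (Coalgebra.comul h)) := congrArg (fun f => f.ofConv h) h1
  rw [h2]
  generalize (Coalgebra.comul h : H ⊗[k] H) = z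
  induction z with
  | zero => simp
  | add a b ha hb => simp only [map_add, ha, hb]
  | tmul a b => simp

variable (k H) in
/-- The inverse of a bijective antipode. -/
def antipodeInv (hS : Function.Bijective (HopfAlgebra.antipode k (A := H))) : H →ₗ[k] H :=
  (LinearEquiv.ofBijective (HopfAlgebra.antipode k) hS).symm.toLinearMap

variable (hS : Function.Bijective (HopfAlgebra.antipode k (A := H)))

theorem antipodeInv_antipode (h : H) : antipodeInv k H hS (HopfAlgebra.antipode k h) = h :=
  (LinearEquiv.ofBijective (HopfAlgebra.antipode k) hS).symm_apply_apply h

theorem antipode_antipodeInv (h : H) : HopfAlgebra.antipode k (antipodeInv k H hS h) = h :=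
  (LinearEquiv.ofBijective (HopfAlgebra.antipode k) hS).apply_symm_apply h

theorem comul_antipodeInv (h : H) :
    Coalgebra.comul (R := k) (antipodeInv k H hS h) =
      TensorProduct.map (antipodeInv k H hS) (antipodeInv k H hS)
        (TensorProduct.comm k H H (Coalgebra.comul h)) := by
  obtain ⟨g, rfl⟩ := hS.2 h
  rw [comul_antipode, antipodeInv_antipode]
  generalize (Coalgebra.comul g : H ⊗[k] H) = z
  induction z with
  | zero => simp
  | add a b ha hb => simp only [map_add, ← ha, ← hb]
  | tmul a b => simp [antipodeInv_antipode]

/-- `S⁻¹(h₂) h₁ = ε(h)`. -/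
theorem mul_antipodeInv_comm_comul (h : H) :
    LinearMap.mul' k H ((antipodeInv k H hS).rTensor H
      (TensorProduct.comm k H H (Coalgebra.comul h))) =
      algebraMap k H (Coalgebra.counit h) := by
  obtain ⟨g, rfl⟩ := hS.2 h
  rw [comul_antipode, HopfAlgebra.counit_antipode,
    ← HopfAlgebra.mul_antipode_lTensor_comul_apply]
  generalize (Coalgebra.comul g : H ⊗[k] H) = z
  induction z with
  | zero => simp
  | add a b ha hb => simp only [map_add, ha, hb]
  | tmul a b => simp [antipodeInv_antipode]

/-- The composite of a convolution inverse of a colinear map with `S⁻¹` is colinear. -/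
theorem isColinear_convInverse_antipodeInv {E : Type*} [Ring E] [Algebra k E]
    (γ : ComoduleAlgebra k H E) {t u : H →ₗ[k] E}
    (ht : IsColinear (RightCoaction.regular k H) γ.toRightCoaction t)
    (htu : toConv t * toConv u = 1) (hut : toConv u * toConv t = 1) :
    IsColinear (RightCoaction.regular k H) γ.toRightCoaction (u ∘ₗ antipodeInv k H hS) := by
  ext g
  have h1 := congrArg (fun f => f.ofConv (antipodeInv k H hS g)) (coact_convInverse γ ht htu hut)
  refine Eq.trans h1 ?_
  change LinearMap.mul' k _ (TensorProduct.map _ _ (Coalgebra.comul (antipodeInv k H hS g))) =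
    (u ∘ₗ antipodeInv k H hS).rTensor H (Coalgebra.comul g)
  rw [comul_antipodeInv]
  generalize (Coalgebra.comul g : H ⊗[k] H) = z
  induction z with
  | zero => simp
  | add a b ha hb => simp only [map_add, ha, hb]
  | tmul a b => simp [antipode_antipodeInv]

end Antipode

section Contraction

variable {k H P : Type*} [CommRing k] [Ring H] [HopfAlgebra k H] [AddCommGroup P] [Module k P]

/-- `(p ⊗ x) ⊗ (h ⊗ h') ↦ (p ⊗ h') ⊗ c(x ⊗ h)`. -/
def midContract (c : H ⊗[k] H →ₗ[k] H) :
    (P ⊗[k] H) ⊗[k] (H ⊗[k] H) →ₗ[k] (P ⊗[k] H) ⊗[k] H :=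
  c.lTensor (P ⊗[k] H) ∘ₗ (TensorProduct.tensorTensorTensorComm k P H H H).toLinearMap ∘ₗ
    (TensorProduct.comm k H H).toLinearMap.lTensor (P ⊗[k] H)

theorem midContract_tmul (c : H ⊗[k] H →ₗ[k] H) (p : P) (x h h' : H) :
    midContract c ((p ⊗ₜ x) ⊗ₜ (h ⊗ₜ h')) = (p ⊗ₜ h') ⊗ₜ c (x ⊗ₜ h) := by
  simp [midContract]

theorem midContract_coact (δ : RightCoaction k H P) (c : H ⊗[k] H →ₗ[k] H)
    (hc : ∀ h, c (Coalgebra.comul h) = algebraMap k H (Coalgebra.counit h)) (p : P) :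
    midContract c (TensorProduct.map δ.coact Coalgebra.comul (δ.coact p)) =
      δ.coact p ⊗ₜ 1 := by
  have hsplit : TensorProduct.map δ.coact (Coalgebra.comul (R := k) (A := H)) (δ.coact p) =
      (Coalgebra.comul (R := k) (A := H)).lTensor (P ⊗[k] H)
        ((TensorProduct.assoc k P H H).symm
          ((Coalgebra.comul (R := k) (A := H)).lTensor P (δ.coact p))) := by
    have h := comulRight_coact δ p
    simp only [comulRight, RightCoaction.cofree, LinearMap.comp_apply, LinearEquiv.coe_coe] at h
    rw [h]
    exact (LinearMap.congr_fun (LinearMap.lTensor_comp_rTensor _ _ _) _).symm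
  rw [hsplit]
  generalize δ.coact p = w
  induction w with
  | zero => simp
  | add a b ha hb => simp only [map_add, ha, hb, TensorProduct.add_tmul]
  | tmul p h =>
    set mid : H ⊗[k] (H ⊗[k] H) →ₗ[k] (P ⊗[k] H) ⊗[k] H := midContract c ∘ₗ
      TensorProduct.map (TensorProduct.mk k P H p) LinearMap.id with hmid
    have e1 : ∀ z : H ⊗[k] H, midContract c
        ((Coalgebra.comul (R := k) (A := H)).lTensor (P ⊗[k] H)
          ((TensorProduct.assoc k P H H).symm (p ⊗ₜ z))) =
        mid ((Coalgebra.comul (R := k) (A := H)).lTensor H z) := by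
      intro z
      induction z with
      | zero => simp
      | add a b ha hb => simp only [TensorProduct.tmul_add, map_add, ha, hb]
      | tmul a b => simp [mid]
    have e2 : ∀ z : H ⊗[k] H,
        mid (TensorProduct.assoc k H H H ((Coalgebra.comul (R := k) (A := H)).rTensor H z)) =
        (TensorProduct.mk k (P ⊗[k] H) H).flip 1 (p ⊗ₜ TensorProduct.lid k H
          ((Coalgebra.counit (R := k) (A := H)).rTensor H z)) := by
      intro z
      induction z with
      | zero => simp
      | add a b ha hb => simp only [TensorProduct.tmul_add, map_add, ha, hb]
      | tmul a b =>
        have e3 : ∀ y : H ⊗[k] H, mid (TensorProduct.assoc k H H H (y ⊗ₜ b)) =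
            (p ⊗ₜ b) ⊗ₜ c y := by
          intro y
          induction y with
          | zero => simp
          | add a b ha hb => simp only [TensorProduct.tmul_add, TensorProduct.add_tmul, map_add,
              ha, hb]
          | tmul x h => simp [mid, midContract_tmul]
        rw [LinearMap.rTensor_tmul, e3, hc]
        simp [Algebra.algebraMap_eq_smul_one, TensorProduct.smul_tmul']
    rw [LinearMap.lTensor_tmul, e1, ← Coalgebra.coassoc_apply, e2]
    simp

/-- Contraction of `(p₀ ⊗ p₁) ⊗ p₂` to `p`. -/
theorem lTensor_contract_coact (δ : RightCoaction k H P) (c : H ⊗[k] H →ₗ[k] H)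
    (hc : ∀ h, c (Coalgebra.comul h) = algebraMap k H (Coalgebra.counit h)) (p : P) :
    c.lTensor P (TensorProduct.assoc k P H H (δ.coact.rTensor H (δ.coact p))) = p ⊗ₜ 1 := by
  have h := LinearMap.congr_fun δ.coassoc p
  have h2 := LinearMap.congr_fun δ.counit p
  simp only [LinearMap.comp_apply, LinearEquiv.coe_coe, LinearMap.id_apply] at h h2
  rw [h, ← LinearMap.lTensor_comp_apply]
  have e := LinearMap.congr_fun (f := (c ∘ₗ Coalgebra.comul).lTensor P)
    (g := (TensorProduct.mk k P H).flip 1 ∘ₗ (TensorProduct.rid k P).toLinearMap ∘ₗ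
      (Coalgebra.counit (R := k) (A := H)).lTensor P)
    (by ext x h; simp [hc, Algebra.algebraMap_eq_smul_one, TensorProduct.smul_tmul'])
    (δ.coact p)
  rw [e]
  simp [h2]

end Contraction

section BalancedFamily

variable {k A : Type*} [CommRing k] [Ring A] [Algebra k A]

variable (S : Subalgebra k A) {Y Q : Type*} [AddCommGroup Y] [Module k Y]
  [AddCommGroup Q] [Module k Q] [Module Sᵐᵒᵖ Q]

/-- A family of right `S`-linear maps `Θ_y : A → Q`, linear in `y`, induces a family
`Θ_y ⊗_S A : A ⊗_S A → Q ⊗_S A`. -/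
def balancedFamily (Θ : Y →ₗ[k] A →ₗ[k] Q)
    (hΘ : ∀ (y : Y) (x : A) (b : S), Θ y (x * b) = op b • Θ y x) :
    Y →ₗ[k] BalTensor k S A A →ₗ[k] BalTensor k S Q A where
  toFun y := BalTensor.lift (BalTensor.proj k S Q A ∘ₗ (Θ y).rTensor A) (fun x b a => by
    simp [subalgebra_op_smul, hΘ, BalTensor.proj_balanced])
  map_add' y y' := BalTensor.hom_ext fun x a => by
    change BalTensor.proj k S Q A (Θ (y + y') x ⊗ₜ a) =
      BalTensor.proj k S Q A (Θ y x ⊗ₜ a) + BalTensor.proj k S Q A (Θ y' x ⊗ₜ a)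
    simp [TensorProduct.add_tmul]
  map_smul' c y := BalTensor.hom_ext fun x a => by
    change BalTensor.proj k S Q A (Θ (c • y) x ⊗ₜ a) =
      c • BalTensor.proj k S Q A (Θ y x ⊗ₜ a)
    simp [← TensorProduct.smul_tmul']

variable {S}

theorem balancedFamily_proj (Θ : Y →ₗ[k] A →ₗ[k] Q)
    (hΘ : ∀ (y : Y) (x : A) (b : S), Θ y (x * b) = op b • Θ y x) (y : Y) (x a : A) :
    balancedFamily S Θ hΘ y (BalTensor.proj k S A A (x ⊗ₜ a)) =
      BalTensor.proj k S Q A (Θ y x ⊗ₜ a) := rfl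

theorem induction_proj {N : Type*} [AddCommGroup N] [Module k N] [Module S N]
    {p : BalTensor k S Q N → Prop} (z : BalTensor k S Q N) (h0 : p 0)
    (hadd : ∀ x y, p x → p y → p (x + y))
    (h : ∀ m a, p (BalTensor.proj k S Q N (m ⊗ₜ a))) : p z := by
  obtain ⟨z, rfl⟩ := BalTensor.proj_surjective z
  induction z with
  | zero => simpa using h0
  | add a b ha hb => rw [map_add]; exact hadd _ _ ha hb
  | tmul m a => exact h m a

theorem balancedFamily_smul (Θ : Y →ₗ[k] A →ₗ[k] Q)
    (hΘ : ∀ (y : Y) (x : A) (b : S), Θ y (x * b) = op b • Θ y x) (y : Y) (a : A)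
    (z : BalTensor k S A A) :
    balancedFamily S Θ hΘ y (op a • z) = op a • balancedFamily S Θ hΘ y z := by
  induction z using induction_proj with
  | h0 => simp
  | hadd x y hx hy => simp only [smul_add, map_add, hx, hy]
  | h x b => simp only [induced_smul_proj, balancedFamily_proj]

variable (S) in
/-- Left multiplication `a (x ⊗ y) = a x ⊗ y` on `A ⊗_S A`. -/
def leftMul : A →ₗ[k] BalTensor k S A A →ₗ[k] BalTensor k S A A :=
  balancedFamily S (LinearMap.mul k A) fun y x b => by simp [subalgebra_op_smul, mul_assoc]

theorem leftMul_proj (a x y : A) :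
    leftMul S a (BalTensor.proj k S A A (x ⊗ₜ y)) = BalTensor.proj k S A A ((a * x) ⊗ₜ y) := rfl

theorem balancedFamily_leftMul {Y' : Type*} [AddCommGroup Y'] [Module k Y']
    (Θ : Y →ₗ[k] A →ₗ[k] Q) (hΘ : ∀ (y : Y) (x : A) (b : S), Θ y (x * b) = op b • Θ y x)
    (Θ' : Y' →ₗ[k] A →ₗ[k] Q) (hΘ' : ∀ (y : Y') (x : A) (b : S), Θ' y (x * b) = op b • Θ' y x)
    {y : Y} {y' : Y'} {a : A} (h : ∀ x, Θ' y' x = Θ y (a * x)) (z : BalTensor k S A A) :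
    balancedFamily S Θ' hΘ' y' z = balancedFamily S Θ hΘ y (leftMul S a z) := by
  induction z using induction_proj with
  | h0 => simp
  | hadd x y hx hy => simp only [map_add, hx, hy]
  | h x b => simp only [leftMul_proj, balancedFamily_proj, h]

variable (S) in
/-- The multiplication `A ⊗_S A → A`. -/
def balMul : BalTensor k S A A →ₗ[k] A :=
  BalTensor.lift (LinearMap.mul' k A) fun x b a => by
    simp [subalgebra_op_smul, Subalgebra.smul_def, mul_assoc]

theorem balMul_proj (x y : A) : balMul S (BalTensor.proj k S A A (x ⊗ₜ y)) = x * y := rfl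

end BalancedFamily

section Translation

variable {k H A : Type*} [CommRing k] [Ring H] [HopfAlgebra k H] [Ring A] [Algebra k A]
  (ρ : ComoduleAlgebra k H A)

theorem can_proj (x y : A) :
    ρ.can (BalTensor.proj k ρ.coinvariants A A (x ⊗ₜ y)) = (x ⊗ₜ 1) * ρ.coact y := rfl

theorem can_leftMul (a : A) (z : BalTensor k ρ.coinvariants A A) :
    ρ.can (leftMul ρ.coinvariants a z) = (a ⊗ₜ 1) * ρ.can z := by
  induction z using induction_proj with
  | h0 => simp
  | hadd x y hx hy => simp only [map_add, mul_add, hx, hy]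
  | h x b => simp [leftMul_proj, can_proj, ← mul_assoc]

theorem can_smul (a : A) (z : BalTensor k ρ.coinvariants A A) :
    ρ.can (op a • z) = ρ.can z * ρ.coact a := by
  induction z using induction_proj with
  | h0 => simp
  | hadd x y hx hy => simp only [smul_add, map_add, add_mul, hx, hy]
  | h x b => simp [induced_smul_proj, can_proj, mul_assoc]

theorem tmul_one_mul (x : A) (w : A ⊗[k] H) :
    (x ⊗ₜ[k] (1 : H)) * w = (LinearMap.mulLeft k x).rTensor H w :=
  LinearMap.congr_fun (f := LinearMap.mulLeft k (x ⊗ₜ[k] (1 : H)))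
    (g := (LinearMap.mulLeft k x).rTensor H) (by ext; simp) w

variable {ρ} (hcan : Function.Bijective ρ.can)

/-- The translation map `h ↦ l(h) ⊗ r(h) = can⁻¹(1 ⊗ h)`. -/
def translation : H →ₗ[k] BalTensor k ρ.coinvariants A A :=
  (LinearEquiv.ofBijective ρ.can hcan).symm.toLinearMap ∘ₗ TensorProduct.mk k A H 1

theorem can_translation (h : H) : ρ.can (translation hcan h) = 1 ⊗ₜ h :=
  (LinearEquiv.ofBijective ρ.can hcan).apply_symm_apply _

theorem can_rTensor_injective (hcan : Function.Bijective ρ.can) :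
    Function.Injective (ρ.can.rTensor H) :=
  ((LinearEquiv.ofBijective ρ.can hcan).rTensor H).injective

/-- `b l(h) ⊗ r(h) = l(h) ⊗ r(h) b`. -/
theorem leftMul_translation (b : ρ.coinvariants) (h : H) :
    leftMul ρ.coinvariants (b : A) (translation hcan h) = op (b : A) • translation hcan h := by
  apply hcan.1
  rw [can_leftMul, can_smul, can_translation, ρ.coact_coinvariant]
  simp

theorem translation_one :
    translation hcan 1 = BalTensor.proj k ρ.coinvariants A A (1 ⊗ₜ 1) := by
  apply hcan.1
  rw [can_translation, can_proj, map_one, mul_one]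

theorem can_rTensor_inducedCoact (z : BalTensor k ρ.coinvariants A A) :
    ρ.can.rTensor H (inducedCoact ρ A z) = comulRight k H A (ρ.can z) := by
  induction z using induction_proj with
  | h0 => simp
  | hadd x y hx hy => simp only [map_add, hx, hy]
  | h x y =>
    have e : ρ.can ∘ₗ BalTensor.proj k ρ.coinvariants A A ∘ₗ TensorProduct.mk k A A x =
        (LinearMap.mulLeft k x).rTensor H ∘ₗ ρ.coact.toLinearMap := by
      ext y
      exact (can_proj ρ x y).trans (tmul_one_mul x _)
    rw [inducedCoact_proj, ← LinearMap.rTensor_comp_apply, e, LinearMap.rTensor_comp_apply,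
      can_proj, tmul_one_mul, comulRight_rTensor]
    exact congrArg _ (comulRight_coact ρ.toRightCoaction y).symm

/-- `l(h) ⊗ r(h)₀ ⊗ r(h)₁ = l(h₁) ⊗ r(h₁) ⊗ h₂`. -/
theorem inducedCoact_translation (h : H) :
    inducedCoact ρ A (translation hcan h) =
      (translation hcan).rTensor H (Coalgebra.comul h) := by
  apply can_rTensor_injective hcan
  rw [can_rTensor_inducedCoact, can_translation, ← LinearMap.rTensor_comp_apply]
  simp only [comulRight, RightCoaction.cofree, LinearMap.comp_apply, LinearMap.lTensor_tmul,
    LinearEquiv.coe_coe]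
  generalize (Coalgebra.comul h : H ⊗[k] H) = z
  induction z with
  | zero => simp
  | add a b ha hb => simp only [TensorProduct.tmul_add, map_add, ha, hb]
  | tmul a b => simp [can_translation]

variable (ρ) in
/-- `x ⊗ y ↦ (x₀ ⊗ y) ⊗ x₁` on `A ⊗_B A`. -/
def leftFactorCoact : BalTensor k ρ.coinvariants A A →ₗ[k]
    BalTensor k ρ.coinvariants A A ⊗[k] H :=
  BalTensor.lift (TensorProduct.lift ((LinearMap.rTensorHom H ∘ₗ
      ((TensorProduct.mk k A A).compr₂ (BalTensor.proj k ρ.coinvariants A A)).flip).flip ∘ₗ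
        ρ.coact.toLinearMap)) (fun x b y => by
    simp only [TensorProduct.lift.tmul, LinearMap.comp_apply, LinearMap.flip_apply,
      AlgHom.toLinearMap_apply, subalgebra_op_smul, map_mul, ρ.coact_coinvariant]
    generalize ρ.coact x = z
    induction z with
    | zero => simp
    | add a b ha hb => simp only [add_mul, map_add, ha, hb]
    | tmul a h =>
      simp [← BalTensor.proj_balanced, subalgebra_op_smul])

theorem leftFactorCoact_proj (x y : A) :
    leftFactorCoact ρ (BalTensor.proj k ρ.coinvariants A A (x ⊗ₜ y)) =
      (BalTensor.proj k ρ.coinvariants A A ∘ₗ (TensorProduct.mk k A A).flip y).rTensor H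
        (ρ.coact x) := rfl

variable (ρ) in
/-- `a ⊗ h ↦ (a₀ ⊗ h₂) ⊗ a₁ S(h₁)`. -/
def twistedCoact : A ⊗[k] H →ₗ[k] (A ⊗[k] H) ⊗[k] H :=
  midContract (LinearMap.mul' k H ∘ₗ (HopfAlgebra.antipode k (A := H)).lTensor H) ∘ₗ
    TensorProduct.map ρ.coact.toLinearMap Coalgebra.comul

theorem can_rTensor_leftFactorCoact (z : BalTensor k ρ.coinvariants A A) :
    ρ.can.rTensor H (leftFactorCoact ρ z) = twistedCoact ρ (ρ.can z) := by
  induction z using induction_proj with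
  | h0 => simp
  | hadd x y hx hy => simp only [map_add, hx, hy]
  | h x y =>
    set c := LinearMap.mul' k H ∘ₗ (HopfAlgebra.antipode k (A := H)).lTensor H with hc
    have e1 : ∀ w : A ⊗[k] H, TensorProduct.map ρ.coact.toLinearMap
        (Coalgebra.comul (R := k) (A := H)) ((x ⊗ₜ 1) * w) =
        (LinearMap.mulLeft k (ρ.coact x)).rTensor (H ⊗[k] H)
          (TensorProduct.map ρ.coact.toLinearMap Coalgebra.comul w) := by
      intro w
      induction w with
      | zero => simp
      | add a b ha hb => simp only [mul_add, map_add, ha, hb]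
      | tmul a h => simp
    have e2 : ∀ (v : A ⊗[k] H) (w : (A ⊗[k] H) ⊗[k] (H ⊗[k] H)),
        midContract c ((LinearMap.mulLeft k v).rTensor (H ⊗[k] H) w) =
        TensorProduct.map₂ (LinearMap.mul k (A ⊗[k] H) ∘ₗ
          (Algebra.TensorProduct.includeLeft : A →ₐ[k] A ⊗[k] H).toLinearMap)
          (LinearMap.mul k H) v (midContract c w) := by
      intro v w
      induction v with
      | zero => simp
      | add a b ha hb =>
        rw [map_add, LinearMap.add_apply, ← ha, ← hb, ← map_add, ← LinearMap.add_apply,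
          ← LinearMap.rTensor_add]
        congr 3
        ext
        all_goals simp [add_mul]
      | tmul a g =>
        induction w with
        | zero => simp
        | add a b ha hb => simp only [map_add, ha, hb]
        | tmul p q =>
          induction p with
          | zero => simp
          | add a b ha hb => simp only [TensorProduct.add_tmul, map_add, ha, hb]
          | tmul a' x =>
            induction q with
            | zero => simp
            | add a b ha hb => simp only [TensorProduct.tmul_add, map_add, ha, hb]
            | tmul h h' => simp [midContract_tmul, c, mul_assoc]
    rw [leftFactorCoact_proj, can_proj, twistedCoact, LinearMap.comp_apply, e1, e2]
    have e3 := midContract_coact ρ.toRightCoaction c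
      (fun h => HopfAlgebra.mul_antipode_lTensor_comul_apply h) y
    change midContract c (TensorProduct.map ρ.coact.toLinearMap Coalgebra.comul (ρ.coact y)) =
      ρ.coact y ⊗ₜ 1 at e3
    rw [e3]
    generalize ρ.coact x = z
    induction z with
    | zero => simp
    | add a b ha hb => simp only [map_add, ha, hb, LinearMap.add_apply]
    | tmul a h => simp [can_proj]

/-- `l(h)₀ ⊗ r(h) ⊗ l(h)₁ = l(h₂) ⊗ r(h₂) ⊗ S(h₁)`. -/
theorem leftFactorCoact_translation (h : H) :
    leftFactorCoact ρ (translation hcan h) =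
      TensorProduct.map (translation hcan) (HopfAlgebra.antipode k)
        (TensorProduct.comm k H H (Coalgebra.comul h)) := by
  apply can_rTensor_injective hcan
  rw [can_rTensor_leftFactorCoact, can_translation]
  simp only [twistedCoact, LinearMap.comp_apply, TensorProduct.map_tmul, AlgHom.toLinearMap_apply,
    map_one, Algebra.TensorProduct.one_def]
  generalize (Coalgebra.comul h : H ⊗[k] H) = z
  induction z with
  | zero => simp
  | add a b ha hb => simp only [TensorProduct.tmul_add, map_add, ha, hb]
  | tmul a b => simp [midContract_tmul, can_translation]

/-- `l(h) r(h) = ε(h)`. -/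
theorem balMul_translation (h : H) :
    balMul ρ.coinvariants (translation hcan h) = algebraMap k A (Coalgebra.counit h) := by
  have e : ∀ z, balMul ρ.coinvariants z = TensorProduct.rid k A
      ((Coalgebra.counit (R := k) (A := H)).lTensor A (ρ.can z)) := by
    intro z
    induction z using induction_proj with
    | h0 => simp
    | hadd x y hx hy => simp only [map_add, hx, hy]
    | h x y =>
      have h0 : TensorProduct.rid k A ((Coalgebra.counit (R := k) (A := H)).lTensor A
        (ρ.coact y)) = y := LinearMap.congr_fun ρ.counit y
      rw [balMul_proj, can_proj]
      conv_lhs => rw [← h0]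
      generalize ρ.coact y = w
      induction w with
      | zero => simp
      | add a b ha hb => simp only [mul_add, map_add, ha, hb]
      | tmul a b => simp
  rw [e, can_translation]
  simp [Algebra.algebraMap_eq_smul_one]

/-- `x₀ l(x₁) ⊗ r(x₁) = 1 ⊗ x`. -/
theorem leftMul_translation_coact (x : A) :
    TensorProduct.lift ((leftMul ρ.coinvariants).compl₂ (translation hcan)) (ρ.coact x) =
      BalTensor.proj k ρ.coinvariants A A (1 ⊗ₜ x) := by
  apply hcan.1
  rw [can_proj, ← Algebra.TensorProduct.one_def, one_mul]
  generalize ρ.coact x = w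
  induction w with
  | zero => simp
  | add a b ha hb => simp only [map_add, ha, hb]
  | tmul a b => simp [can_leftMul, can_translation]

/-- `l(S⁻¹(x₁)) ⊗ r(S⁻¹(x₁)) x₀ = x ⊗ 1`. -/
theorem translation_antipodeInv_coact (hS : Function.Bijective (HopfAlgebra.antipode k (A := H)))
    {X : Type*} [AddCommGroup X] [Module k X] (F : A ⊗[k] H →ₗ[k] X)
    (G : BalTensor k ρ.coinvariants A A →ₗ[k] X)
    (hF : ∀ a h, F (a ⊗ₜ h) = G (op a • translation hcan (antipodeInv k H hS h))) (x : A) :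
    F (ρ.coact x) = G (BalTensor.proj k ρ.coinvariants A A (x ⊗ₜ 1)) := by
  set c : H ⊗[k] H →ₗ[k] H := LinearMap.mul' k H ∘ₗ (antipodeInv k H hS).rTensor H ∘ₗ
    (TensorProduct.comm k H H).toLinearMap with hc
  have e := lTensor_contract_coact ρ.toRightCoaction c (mul_antipodeInv_comm_comul hS) x
  have h1 : F = G ∘ₗ (LinearEquiv.ofBijective ρ.can hcan).symm.toLinearMap ∘ₗ
      c.lTensor A ∘ₗ (TensorProduct.assoc k A H H).toLinearMap ∘ₗ
        ρ.coact.toLinearMap.rTensor H := by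
    ext a h
    simp only [TensorProduct.AlgebraTensorModule.curry_apply, TensorProduct.curry_apply,
      LinearMap.coe_restrictScalars, LinearMap.comp_apply, LinearMap.rTensor_tmul, hF,
      LinearEquiv.coe_coe]
    congr 1
    rw [LinearEquiv.eq_symm_apply, LinearEquiv.ofBijective_apply, can_smul, can_translation]
    change _ = c.lTensor A (TensorProduct.assoc k A H H (ρ.coact a ⊗ₜ h))
    generalize ρ.coact a = w
    induction w with
    | zero => simp
    | add a b ha hb => simp only [mul_add, TensorProduct.add_tmul, map_add, ha, hb]
    | tmul a b => simp [c]
  rw [h1]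
  simp only [LinearMap.comp_apply, LinearEquiv.coe_coe]
  change c.lTensor A (TensorProduct.assoc k A H H
    (ρ.coact.toLinearMap.rTensor H (ρ.coact x))) = x ⊗ₜ 1 at e
  rw [e]
  congr 1
  rw [LinearEquiv.symm_apply_eq, LinearEquiv.ofBijective_apply, can_proj, map_one, mul_one]

end Translation

section Action

variable (k A P : Type*) [CommRing k] [Ring A] [Algebra k A]
  [AddCommGroup P] [Module k P] [Module Aᵐᵒᵖ P] [IsScalarTower k Aᵐᵒᵖ P]

/-- The right action `p, a ↦ p a` as a bilinear map. -/
def actRight : P →ₗ[k] A →ₗ[k] P :=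
  LinearMap.mk₂ k (fun p a => op a • p) (fun p q a => smul_add _ _ _)
    (fun c p a => smul_comm _ _ _) (fun p a b => by rw [op_add, add_smul])
    (fun c p a => by rw [op_smul, smul_assoc])

variable {k A P}

theorem actRight_apply (p : P) (a : A) : actRight k A P p a = op a • p := rfl

end Action

section Evaluation

variable {k H A P : Type*} [CommRing k] [Ring H] [HopfAlgebra k H] [Ring A] [Algebra k A]
  [AddCommGroup P] [Module k P] [Module Aᵐᵒᵖ P] [IsScalarTower k Aᵐᵒᵖ P]

/-- `p ⊗ h ↦ G(h)(p)`. -/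
def endEval (G : H →ₗ[k] Module.End Aᵐᵒᵖ P) : P ⊗[k] H →ₗ[k] P :=
  TensorProduct.lift (LinearMap.restrictScalarsₗ k Aᵐᵒᵖ P P k ∘ₗ G).flip

theorem endEval_tmul (G : H →ₗ[k] Module.End Aᵐᵒᵖ P) (p : P) (h : H) :
    endEval G (p ⊗ₜ h) = G h p := rfl

/-- `a ⊗ b ↦ G(a)(G'(b)(p))`. -/
def compEval (G G' : H →ₗ[k] Module.End Aᵐᵒᵖ P) (p : P) : H ⊗[k] H →ₗ[k] P :=
  (LinearMap.applyₗ p ∘ₗ LinearMap.restrictScalarsₗ k Aᵐᵒᵖ P P k) ∘ₗ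
    LinearMap.mul' k (Module.End Aᵐᵒᵖ P) ∘ₗ TensorProduct.map G G'

theorem compEval_tmul (G G' : H →ₗ[k] Module.End Aᵐᵒᵖ P) (p : P) (a b : H) :
    compEval G G' p (a ⊗ₜ b) = G a (G' b p) := rfl

variable (δ : RightCoaction k H P)

/-- The inclusion of `END_A(P)` into `End_A(P)`, applied to a linear map. -/
def toEnd (t : H →ₗ[k] rationalEnd (A := A) δ) : H →ₗ[k] Module.End Aᵐᵒᵖ P :=
  (rationalEnd (A := A) δ).val.toLinearMap ∘ₗ t

variable {δ}

theorem rationalEnd_convMul_eq_one_iff (t u : H →ₗ[k] rationalEnd (A := A) δ) :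
    WithConv.toConv t * WithConv.toConv u = 1 ↔
      ∀ (h : H) (p : P), compEval (toEnd δ t) (toEnd δ u) p (Coalgebra.comul h) =
        Coalgebra.counit (R := k) h • p := by
  have key : ∀ (h : H) (p : P), compEval (toEnd δ t) (toEnd δ u) p (Coalgebra.comul h) =
      ((WithConv.toConv t * WithConv.toConv u).ofConv h).1 p := by
    intro h p
    change _ = (LinearMap.mul' k (rationalEnd (A := A) δ)
      (TensorProduct.map t u (Coalgebra.comul h))).1 p
    generalize (Coalgebra.comul h : H ⊗[k] H) = z
    induction z with
    | zero => simp
    | add a b ha hb => simp only [map_add, ha, hb, Subalgebra.coe_add, LinearMap.add_apply]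
    | tmul a b => rfl
  constructor
  · intro e h p
    rw [key, e]
    exact Module.algebraMap_end_apply (S := Aᵐᵒᵖ) (R := k) (M := P) (Coalgebra.counit h) p
  · intro e
    ext h p
    refine (key h p).symm.trans ((e h p).trans ?_)
    exact (Module.algebraMap_end_apply (S := Aᵐᵒᵖ) (R := k) (M := P) (Coalgebra.counit h) p).symm

/-- A linear map to `End_A(P)` with the coaction values of a colinear map lifts to `END_A(P)`. -/
theorem exists_toEnd_eq (G : H →ₗ[k] Module.End Aᵐᵒᵖ P)
    (hG : ∀ h, IsCoactionValue δ (G h) (G.rTensor H (Coalgebra.comul h))) :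
    ∃ t : H →ₗ[k] rationalEnd (A := A) δ, toEnd δ t = G :=
  ⟨G.codRestrict (Subalgebra.toSubmodule (rationalEnd (A := A) δ)) fun h => ⟨_, hG h⟩, rfl⟩

variable [Module.Projective k H]

theorem isColinear_rationalEnd_iff (t : H →ₗ[k] rationalEnd (A := A) δ) :
    IsColinear (RightCoaction.regular k H) (endComoduleAlgebra A δ).toRightCoaction t ↔
      ∀ h, IsCoactionValue δ (toEnd δ t h) ((toEnd δ t).rTensor H (Coalgebra.comul h)) := by
  have hr : (rationalEnd (A := A) δ).val.range = rationalEnd δ :=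
    Subalgebra.range_val (rationalEnd δ)
  have hincl : ∀ z : H ⊗[k] H, rationalIncl (rationalEnd (A := A) δ).val (t.rTensor H z) =
      (toEnd δ t).rTensor H z := fun z => by
    rw [rationalIncl_eq, ← LinearMap.rTensor_comp_apply]
    rfl
  constructor
  · intro ht h
    have h1 : rationalCoact δ (rationalEnd (A := A) δ).val hr (t h) =
      t.rTensor H (Coalgebra.comul h) := LinearMap.congr_fun ht h
    have h2 := rationalCoact_spec δ (rationalEnd (A := A) δ).val hr (t h)
    rw [h1, hincl] at h2
    exact h2
  · intro ht
    ext1 h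
    exact rationalCoact_eq δ (rationalEnd (A := A) δ).val Subtype.val_injective hr
      ((congrArg (IsCoactionValue δ (toEnd δ t h)) (hincl (Coalgebra.comul h))).mpr (ht h))

end Evaluation

section InducedMaps

variable {k A : Type*} [CommRing k] [Ring A] [Algebra k A] (S : Subalgebra k A)
  (M : Type*) [AddCommGroup M] [Module k M] [Module Sᵐᵒᵖ M]

/-- The map `M → M ⊗_S A`, `m ↦ m ⊗ 1`. -/
def unitMap : M →ₗ[k] BalTensor k S M A :=
  BalTensor.proj k S M A ∘ₗ (TensorProduct.mk k M A).flip 1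

variable {M}

theorem unitMap_apply (m : M) : unitMap S M m = BalTensor.proj k S M A (m ⊗ₜ 1) := rfl

theorem op_smul_unitMap (a : A) (m : M) :
    op a • unitMap S M m = BalTensor.proj k S M A (m ⊗ₜ a) := by
  rw [unitMap_apply, induced_smul_proj, one_mul]

theorem unitMap_smul (b : S) (m : M) : unitMap S M (op b • m) = op (b : A) • unitMap S M m := by
  rw [op_smul_unitMap, unitMap_apply, BalTensor.proj_balanced, Subalgebra.smul_def, smul_eq_mul,
    mul_one]

variable {S}

theorem induced_hom_ext {Q : Type*} [AddCommGroup Q] [Module Aᵐᵒᵖ Q]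
    {f g : BalTensor k S M A →ₗ[Aᵐᵒᵖ] Q} (h : ∀ m, f (unitMap S M m) = g (unitMap S M m)) :
    f = g := by
  ext z
  induction z using induction_proj with
  | h0 => simp
  | hadd x y hx hy => simp only [map_add, hx, hy]
  | h m a => rw [← op_smul_unitMap, map_smul, map_smul, h]

variable {Y Q : Type*} [AddCommGroup Y] [Module k Y] [AddCommGroup Q] [Module k Q]
  [Module Aᵐᵒᵖ Q] [IsScalarTower k Aᵐᵒᵖ Q]

/-- A family of right `S`-linear maps `G_y : M → Q` to a right `A`-module extends to a family of
right `A`-linear maps `M ⊗_S A → Q`. -/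
def inducedLift (G : Y →ₗ[k] M →ₗ[k] Q)
    (hG : ∀ y (b : S) m, G y (op b • m) = op (b : A) • G y m) :
    Y →ₗ[k] (BalTensor k S M A →ₗ[Aᵐᵒᵖ] Q) :=
  let f : Y → (BalTensor k S M A →ₗ[k] Q) := fun y =>
    BalTensor.lift (TensorProduct.lift (actRight k A Q ∘ₗ G y)) fun m b a => by
      simp [actRight_apply, hG, Subalgebra.smul_def, mul_smul]
  have hf : ∀ y m a, f y (BalTensor.proj k S M A (m ⊗ₜ a)) = op a • G y m := fun _ _ _ => rfl
  let F : Y → (BalTensor k S M A →ₗ[Aᵐᵒᵖ] Q) := fun y =>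
    { f y with
      map_smul' := fun a z => by
        obtain ⟨a⟩ := a
        change f y (op a • z) = op a • f y z
        induction z using induction_proj with
        | h0 => simp
        | hadd x y hx hy => simp only [smul_add, map_add, hx, hy]
        | h m x => rw [induced_smul_proj, hf, hf, op_mul, mul_smul] }
  have hF : ∀ y m, F y (unitMap S M m) = G y m := fun y m => (hf y m 1).trans (one_smul _ _)
  { toFun := F
    map_add' := fun y y' => induced_hom_ext fun m => by
      rw [LinearMap.add_apply, hF, hF, hF, map_add, LinearMap.add_apply]
    map_smul' := fun c y => induced_hom_ext fun m => by
      rw [RingHom.id_apply, LinearMap.smul_apply, hF, hF, map_smul, LinearMap.smul_apply] }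

theorem inducedLift_proj (G : Y →ₗ[k] M →ₗ[k] Q)
    (hG : ∀ y (b : S) m, G y (op b • m) = op (b : A) • G y m) (y : Y) (m : M) (a : A) :
    inducedLift G hG y (BalTensor.proj k S M A (m ⊗ₜ a)) = op a • G y m := rfl

theorem inducedLift_unitMap (G : Y →ₗ[k] M →ₗ[k] Q)
    (hG : ∀ y (b : S) m, G y (op b • m) = op (b : A) • G y m) (y : Y) (m : M) :
    inducedLift G hG y (unitMap S M m) = G y m :=
  (inducedLift_proj G hG y m 1).trans (one_smul _ _)

end InducedMaps

section InducedCoactionValue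

variable {k H A : Type*} [CommRing k] [Ring H] [HopfAlgebra k H] [Ring A] [Algebra k A]
  (ρ : ComoduleAlgebra k H A)
  {M : Type*} [AddCommGroup M] [Module k M] [Module (ρ.coinvariants)ᵐᵒᵖ M]

theorem inducedCoact_unitMap (m : M) :
    inducedCoact ρ M (unitMap ρ.coinvariants M m) = unitMap ρ.coinvariants M m ⊗ₜ 1 := by
  rw [unitMap_apply, inducedCoact_proj, map_one, Algebra.TensorProduct.one_def,
    LinearMap.rTensor_tmul]
  rfl

/-- The right action of `A ⊗ H` on `P ⊗ H`. -/
def actTensor (k H A P : Type*) [CommRing k] [Ring H] [Algebra k H] [Ring A] [Algebra k A]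
    [AddCommGroup P] [Module k P] [Module Aᵐᵒᵖ P] [IsScalarTower k Aᵐᵒᵖ P] :
    P ⊗[k] H →ₗ[k] A ⊗[k] H →ₗ[k] P ⊗[k] H :=
  TensorProduct.map₂ (actRight k A P) (LinearMap.mul k H)

theorem inducedCoact_smul (a : A) (p : BalTensor k ρ.coinvariants M A) :
    inducedCoact ρ M (op a • p) = actTensor k H A _ (inducedCoact ρ M p) (ρ.coact a) := by
  induction p using induction_proj with
  | h0 => simp
  | hadd x y hx hy => simp only [smul_add, map_add, LinearMap.add_apply, hx, hy]
  | h m x =>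
    rw [induced_smul_proj, inducedCoact_proj, inducedCoact_proj, map_mul]
    generalize ρ.coact a = w
    generalize ρ.coact x = v
    induction w with
    | zero => simp
    | add a b ha hb => simp only [mul_add, map_add, ha, hb]
    | tmul a h =>
      induction v with
      | zero => simp
      | add a b ha hb => simp only [add_mul, map_add, LinearMap.add_apply, ha, hb]
      | tmul x g => simp [actTensor, actRight_apply, induced_smul_proj]

theorem tensorAct_actTensor {P : Type*} [AddCommGroup P] [Module k P] [Module Aᵐᵒᵖ P]
    [IsScalarTower k Aᵐᵒᵖ P] (ξ : Module.End Aᵐᵒᵖ P ⊗[k] H) (z : P ⊗[k] H) (w : A ⊗[k] H) :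
    tensorAct ξ (actTensor k H A P z w) = actTensor k H A P (tensorAct ξ z) w := by
  induction ξ with
  | zero => simp
  | add a b ha hb => simp only [map_add, LinearMap.add_apply, ha, hb]
  | tmul f g =>
    induction w with
    | zero => simp
    | add a b ha hb => simp only [map_add, ha, hb]
    | tmul a h =>
      induction z with
      | zero => simp
      | add a b ha hb => simp only [map_add, LinearMap.add_apply, ha, hb]
      | tmul p x => simp [actTensor, actRight_apply, tensorAct_tmul, mul_assoc]

theorem tensorAct_tmul_one {P : Type*} [AddCommGroup P] [Module k P] [Module Aᵐᵒᵖ P]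
    [IsScalarTower k Aᵐᵒᵖ P] (ξ : Module.End Aᵐᵒᵖ P ⊗[k] H) (p : P) :
    tensorAct ξ (p ⊗ₜ 1) = tensorEval p ξ := by
  induction ξ with
  | zero => simp
  | add a b ha hb => simp only [map_add, LinearMap.add_apply, ha, hb]
  | tmul f g => simp [tensorAct_tmul, tensorEval_tmul]

/-- Coaction values of `A`-linear endomorphisms of `M ⊗_B A` can be tested on `M`. -/
theorem isCoactionValue_of_unitMap {f : Module.End Aᵐᵒᵖ (BalTensor k ρ.coinvariants M A)}
    {ξ : Module.End Aᵐᵒᵖ (BalTensor k ρ.coinvariants M A) ⊗[k] H}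
    (h : ∀ m, inducedCoact ρ M (f (unitMap ρ.coinvariants M m)) =
      tensorEval (unitMap ρ.coinvariants M m) ξ) :
    IsCoactionValue (RightCoaction.induced ρ M) f ξ := by
  intro p
  change inducedCoact ρ M (f p) = tensorAct ξ (inducedCoact ρ M p)
  induction p using induction_proj with
  | h0 => simp
  | hadd x y hx hy => simp only [map_add, hx, hy]
  | h m a =>
    rw [← op_smul_unitMap, map_smul, inducedCoact_smul, h, inducedCoact_smul,
      tensorAct_actTensor, inducedCoact_unitMap, tensorAct_tmul_one]

theorem tensorEval_rTensor {P : Type*} [AddCommGroup P] [Module k P] [Module Aᵐᵒᵖ P]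
    [IsScalarTower k Aᵐᵒᵖ P] (G : H →ₗ[k] Module.End Aᵐᵒᵖ P) (p : P) (z : H ⊗[k] H) :
    tensorEval p (G.rTensor H z) =
      (endEval G ∘ₗ TensorProduct.mk k P H p).rTensor H z := by
  rw [tensorEval, ← LinearMap.rTensor_comp_apply]
  rfl

end InducedCoactionValue

namespace BalTensor

variable {k B : Type*} [CommRing k] [Ring B] [Algebra k B]
  {X Y Z : Type*} [AddCommGroup X] [Module k X] [Module Bᵐᵒᵖ X] [IsScalarTower k Bᵐᵒᵖ X]
  [AddCommGroup Y] [Module k Y] [Module Bᵐᵒᵖ Y] [IsScalarTower k Bᵐᵒᵖ Y]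
  [AddCommGroup Z] [Module k Z] [Module Bᵐᵒᵖ Z] [IsScalarTower k Bᵐᵒᵖ Z]
  (N : Type*) [AddCommGroup N] [Module k N] [Module B N]

theorem rTensor_proj (f : X →ₗ[Bᵐᵒᵖ] Y) (m : X) (n : N) :
    rTensor (k := k) N f (proj k B X N (m ⊗ₜ n)) = proj k B Y N (f m ⊗ₜ n) := rfl

theorem rTensor_comp (g : Y →ₗ[Bᵐᵒᵖ] Z) (f : X →ₗ[Bᵐᵒᵖ] Y) :
    rTensor (k := k) N (g ∘ₗ f) = rTensor (k := k) N g ∘ₗ rTensor (k := k) N f :=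
  hom_ext fun _ _ => rfl

theorem rTensor_id : rTensor (k := k) N (LinearMap.id : X →ₗ[Bᵐᵒᵖ] X) = LinearMap.id :=
  hom_ext fun _ _ => rfl

theorem rTensor_zero : rTensor (k := k) N (0 : X →ₗ[Bᵐᵒᵖ] Y) = 0 :=
  hom_ext fun m n => by rw [rTensor_proj]; simp

/-- The isomorphism `e ⊗_B N` induced by an isomorphism `e`. -/
def rTensorEquiv (e : X ≃ₗ[Bᵐᵒᵖ] Y) : BalTensor k B X N ≃ₗ[k] BalTensor k B Y N :=
  LinearEquiv.ofLinearMap (rTensor (k := k) N e.toLinearMap) (rTensor (k := k) N e.symm.toLinearMap)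
    (by rw [← rTensor_comp, LinearEquiv.comp_symm, rTensor_id])
    (by rw [← rTensor_comp, LinearEquiv.symm_comp, rTensor_id])

end BalTensor

section FaithfullyFlat

/-- Exactness is reflected by a faithfully flat module, in universes below the one of the
definition. -/
theorem IsLeftFaithfullyFlat.exact_of_exact.{z₁, z₂, z₃, z, a, b, c} {k : Type a} {B : Type b}
    {N : Type c} [CommRing k] [Ring B] [Algebra k B] [AddCommGroup N] [Module k N] [Module B N]
    (h : IsLeftFaithfullyFlat.{max z₁ z₂ z₃ z} k B N)
    {X : Type z₁} {Y : Type z₂} {Z : Type z₃}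
    [AddCommGroup X] [Module k X] [Module Bᵐᵒᵖ X] [IsScalarTower k Bᵐᵒᵖ X]
    [AddCommGroup Y] [Module k Y] [Module Bᵐᵒᵖ Y] [IsScalarTower k Bᵐᵒᵖ Y]
    [AddCommGroup Z] [Module k Z] [Module Bᵐᵒᵖ Z] [IsScalarTower k Bᵐᵒᵖ Z]
    (f : X →ₗ[Bᵐᵒᵖ] Y) (g : Y →ₗ[Bᵐᵒᵖ] Z)
    (hfg : Function.Exact (BalTensor.rTensor (k := k) N f) (BalTensor.rTensor (k := k) N g)) :
    Function.Exact f g := by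
  let eX : ULift.{max z₁ z₂ z₃ z} X ≃ₗ[Bᵐᵒᵖ] X := ULift.moduleEquiv
  let eY : ULift.{max z₁ z₂ z₃ z} Y ≃ₗ[Bᵐᵒᵖ] Y := ULift.moduleEquiv
  let eZ : ULift.{max z₁ z₂ z₃ z} Z ≃ₗ[Bᵐᵒᵖ] Z := ULift.moduleEquiv
  have h1 := h (ULift.{max z₁ z₂ z₃ z} X) (ULift.{max z₁ z₂ z₃ z} Y)
    (ULift.{max z₁ z₂ z₃ z} Z) (eY.symm.toLinearMap ∘ₗ f ∘ₗ eX.toLinearMap)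
    (eZ.symm.toLinearMap ∘ₗ g ∘ₗ eY.toLinearMap)
  have h2 : Function.Exact (eY.symm.toLinearMap ∘ₗ f ∘ₗ eX.toLinearMap)
      (eZ.symm.toLinearMap ∘ₗ g ∘ₗ eY.toLinearMap) ↔ Function.Exact f g :=
    (LinearMap.exact_iff_of_surjective_of_bijective_of_injective _ _ _ _
      eX.toLinearMap eY.toLinearMap eZ.toLinearMap (by ext; simp) (by ext; simp)
      eX.surjective eY.bijective eZ.injective)
  refine h2.1 (h1.2 ?_)
  refine (LinearMap.exact_iff_of_surjective_of_bijective_of_injective _ _ _ _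
      (BalTensor.rTensorEquiv (k := k) N eX).toLinearMap
      (BalTensor.rTensorEquiv (k := k) N eY).toLinearMap
      (BalTensor.rTensorEquiv (k := k) N eZ).toLinearMap
      (BalTensor.hom_ext fun _ _ => rfl) (BalTensor.hom_ext fun _ _ => rfl)
      (LinearEquiv.surjective _) (LinearEquiv.bijective _) (LinearEquiv.injective _)).2 hfg

end FaithfullyFlat

section InducedRestrict

variable {k A : Type*} [CommRing k] [Ring A] [Algebra k A] (S : Subalgebra k A)
  (M : Type*) [AddCommGroup M] [Module k M] [Module Sᵐᵒᵖ M]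

/-- The right `A`-module `M ⊗_S A` as a right `S`-module. -/
instance inducedRestrictModule : Module Sᵐᵒᵖ (BalTensor k S M A) :=
  Module.compHom (BalTensor k S M A) (RingHom.op S.val.toRingHom)

theorem induced_restrict_smul (b : S) (z : BalTensor k S M A) : op b • z = op (b : A) • z := rfl

instance inducedRestrictTower : IsScalarTower k Sᵐᵒᵖ (BalTensor k S M A) where
  smul_assoc c b z := by
    obtain ⟨b⟩ := b
    exact smul_assoc c (op (b : A)) z

variable {M} in
/-- `M → M ⊗_S A` as a right `S`-linear map. -/
def unitMapRight : M →ₗ[Sᵐᵒᵖ] BalTensor k S M A :=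
  { unitMap S M with
    map_smul' := fun b m => by
      obtain ⟨b⟩ := b
      exact unitMap_smul S b m }

theorem rTensor_unitMapRight_injective [IsScalarTower k Sᵐᵒᵖ M] :
    Function.Injective (BalTensor.rTensor (k := k) A (unitMapRight (M := M) S)) := by
  have hb : ∀ (p : BalTensor k S M A) (b : S) (a : A),
      op (b • a) • p = op a • op b • p := fun p b a => by
    rw [induced_restrict_smul, ← mul_smul]
    rfl
  refine Function.LeftInverse.injective (g := BalTensor.lift
    (TensorProduct.lift (actRight k A (BalTensor k S M A)))
    fun p b a => (hb p b a).symm) fun z => ?_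
  induction z using induction_proj with
  | h0 => simp
  | hadd x y hx hy => simp only [map_add, hx, hy]
  | h m a => exact op_smul_unitMap S a m

end InducedRestrict

section Coinvariants

variable {k H A : Type*} [CommRing k] [Ring H] [HopfAlgebra k H] [Ring A] [Algebra k A]
  (ρ : ComoduleAlgebra k H A)
  (M : Type*) [AddCommGroup M] [Module k M] [Module (ρ.coinvariants)ᵐᵒᵖ M]

/-- The map `p ↦ p₀ ⊗ p₁ - p ⊗ 1` on `M ⊗_B A`. -/
def coinvariantDefect : BalTensor k ρ.coinvariants M A →ₗ[(ρ.coinvariants)ᵐᵒᵖ]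
    BalTensor k ρ.coinvariants M A ⊗[k] H :=
  { inducedCoact ρ M - (TensorProduct.mk k _ H).flip 1 with
    map_smul' := fun b p => by
      obtain ⟨b⟩ := b
      change inducedCoact ρ M (op (b : A) • p) - (op (b : A) • p) ⊗ₜ 1 =
        op b • (inducedCoact ρ M p - p ⊗ₜ 1)
      rw [inducedCoact_smul, ρ.coact_coinvariant, smul_sub, TensorProduct.smul_tmul']
      congr 1
      generalize inducedCoact ρ M p = z
      induction z with
      | zero => simp
      | add a b ha hb => simp only [map_add, LinearMap.add_apply, smul_add, ha, hb]
      | tmul p h =>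
        simp [actTensor, actRight_apply, TensorProduct.smul_tmul', induced_restrict_smul] }

theorem coinvariantDefect_apply (p : BalTensor k ρ.coinvariants M A) :
    coinvariantDefect ρ M p = inducedCoact ρ M p - p ⊗ₜ 1 := rfl

variable {ρ M} (hcan : Function.Bijective ρ.can)

/-- The map `p ⊗ h ↦ p l(h) ⊗ r(h)`. -/
def translationSection : BalTensor k ρ.coinvariants M A ⊗[k] H →ₗ[k]
    BalTensor k ρ.coinvariants (BalTensor k ρ.coinvariants M A) A :=
  TensorProduct.lift ((balancedFamily ρ.coinvariants
    (actRight k A (BalTensor k ρ.coinvariants M A)) fun p x b => by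
      rw [actRight_apply, actRight_apply, op_mul, mul_smul, induced_restrict_smul]).compl₂
    (translation hcan))

theorem translationSection_smul (b : ρ.coinvariants)
    (z : BalTensor k ρ.coinvariants M A ⊗[k] H) :
    translationSection hcan (op b • z) = op (b : A) • translationSection hcan z := by
  induction z with
  | zero => simp
  | add a b ha hb => simp only [smul_add, map_add, ha, hb]
  | tmul p h =>
    rw [TensorProduct.smul_tmul']
    simp only [translationSection, TensorProduct.lift.tmul, LinearMap.compl₂_apply]
    rw [← balancedFamily_smul, ← leftMul_translation hcan b h]
    refine balancedFamily_leftMul _ _ _ _ (fun x => ?_) _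
    rw [actRight_apply, actRight_apply, op_mul, mul_smul, induced_restrict_smul]

theorem translationSection_tmul_one (p : BalTensor k ρ.coinvariants M A) :
    translationSection hcan (p ⊗ₜ 1) =
      BalTensor.proj k ρ.coinvariants (BalTensor k ρ.coinvariants M A) A (p ⊗ₜ 1) := by
  simp only [translationSection, TensorProduct.lift.tmul, LinearMap.compl₂_apply,
    translation_one, balancedFamily_proj, actRight_apply, op_one, one_smul]

theorem translationSection_inducedCoact (m : M) (x : A) :
    translationSection hcan (inducedCoact ρ M (BalTensor.proj k ρ.coinvariants M A (m ⊗ₜ x))) =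
      BalTensor.proj k ρ.coinvariants (BalTensor k ρ.coinvariants M A) A
        (unitMap ρ.coinvariants M m ⊗ₜ x) := by
  have hΘ : ∀ (p : BalTensor k ρ.coinvariants M A) (x : A) (b : ρ.coinvariants),
      actRight k A (BalTensor k ρ.coinvariants M A) p (x * b) =
        op b • actRight k A (BalTensor k ρ.coinvariants M A) p x := fun p x b => by
    rw [actRight_apply, actRight_apply, op_mul, mul_smul, induced_restrict_smul]
  have e : ∀ w : A ⊗[k] H, translationSection hcan ((BalTensor.proj k ρ.coinvariants M A ∘ₗ
      TensorProduct.mk k M A m).rTensor H w) =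
      balancedFamily ρ.coinvariants (actRight k A (BalTensor k ρ.coinvariants M A)) hΘ
        (unitMap ρ.coinvariants M m)
        (TensorProduct.lift ((leftMul ρ.coinvariants).compl₂ (translation hcan)) w) := by
    intro w
    induction w with
    | zero => simp
    | add a b ha hb => simp only [map_add, ha, hb]
    | tmul a h =>
      simp only [translationSection, LinearMap.rTensor_tmul, TensorProduct.lift.tmul,
        LinearMap.compl₂_apply, LinearMap.comp_apply, TensorProduct.mk_apply]
      refine balancedFamily_leftMul _ _ _ _ (fun x => ?_) _
      rw [actRight_apply, actRight_apply, op_smul_unitMap, induced_smul_proj]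
  rw [inducedCoact_proj, e, leftMul_translation_coact, balancedFamily_proj, actRight_apply,
    op_one, one_smul]

theorem exact_rTensor_unitMapRight_coinvariantDefect (hcan : Function.Bijective ρ.can)
    [IsScalarTower k (ρ.coinvariants)ᵐᵒᵖ M] :
    Function.Exact (BalTensor.rTensor (k := k) A (unitMapRight (M := M) ρ.coinvariants))
      (BalTensor.rTensor (k := k) A (coinvariantDefect ρ M)) := by
  intro z
  constructor
  · intro hz
    let s : BalTensor k ρ.coinvariants (BalTensor k ρ.coinvariants M A ⊗[k] H) A →ₗ[k]
        BalTensor k ρ.coinvariants (BalTensor k ρ.coinvariants M A) A :=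
      BalTensor.lift (TensorProduct.lift (actRight k A _ ∘ₗ translationSection hcan))
        (fun q b a => by
          simp only [TensorProduct.lift.tmul, LinearMap.comp_apply, actRight_apply]
          rw [translationSection_smul, ← mul_smul]
          rfl)
    have hs : ∀ q a, s (BalTensor.proj k ρ.coinvariants _ A (q ⊗ₜ a)) =
        op a • translationSection hcan q := fun _ _ => rfl
    have key : ∀ z, ∃ y, s (BalTensor.rTensor (k := k) A (coinvariantDefect ρ M) z) =
        BalTensor.rTensor (k := k) A (unitMapRight (M := M) ρ.coinvariants) y - z := by
      intro z
      induction z using induction_proj with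
      | h0 => exact ⟨0, by simp⟩
      | hadd x y hx hy =>
        obtain ⟨x', hx⟩ := hx
        obtain ⟨y', hy⟩ := hy
        exact ⟨x' + y', by rw [map_add, map_add, map_add, hx, hy]; abel⟩
      | h p a =>
        rw [BalTensor.rTensor_proj, hs, coinvariantDefect_apply, map_sub,
          translationSection_tmul_one, smul_sub, induced_smul_proj, one_mul]
        induction p using induction_proj with
        | h0 => exact ⟨0, by simp⟩
        | hadd x y hx hy =>
          obtain ⟨x', hx⟩ := hx
          obtain ⟨y', hy⟩ := hy
          refine ⟨x' + y', ?_⟩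
          rw [sub_left_inj] at hx hy ⊢
          rw [map_add, map_add, smul_add, hx, hy, map_add]
        | h m x =>
          refine ⟨BalTensor.proj k ρ.coinvariants M A (m ⊗ₜ (x * a)), ?_⟩
          rw [translationSection_inducedCoact, induced_smul_proj]
          rfl
    obtain ⟨y, hy⟩ := key z
    rw [hz, map_zero] at hy
    exact ⟨y, sub_eq_zero.1 hy.symm⟩
  · rintro ⟨y, rfl⟩
    induction y using induction_proj with
    | h0 => simp
    | hadd x y hx hy => rw [map_add, map_add, hx, hy, add_zero]
    | h m a =>
      rw [BalTensor.rTensor_proj, BalTensor.rTensor_proj, coinvariantDefect_apply]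
      change BalTensor.proj k _ _ A ((inducedCoact ρ M (unitMap ρ.coinvariants M m) - _) ⊗ₜ a) = 0
      rw [inducedCoact_unitMap]
      change BalTensor.proj k _ _ A ((unitMap ρ.coinvariants M m ⊗ₜ 1 -
        unitMap ρ.coinvariants M m ⊗ₜ 1) ⊗ₜ a) = 0
      rw [sub_self, TensorProduct.zero_tmul, map_zero]

end Coinvariants

section Descent

variable {k : Type u} {H : Type v} {A : Type w} {M : Type x}
  [CommRing k] [Ring H] [HopfAlgebra k H] [Ring A] [Algebra k A] {ρ : ComoduleAlgebra k H A}
  [AddCommGroup M] [Module k M] [Module (ρ.coinvariants)ᵐᵒᵖ M]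
  [IsScalarTower k (ρ.coinvariants)ᵐᵒᵖ M]

theorem unitMap_injective_of_faithfullyFlat
    (hA : ComoduleAlgebra.IsFaithfullyFlatGalois.{max u v w x} ρ) :
    Function.Injective (unitMap ρ.coinvariants M) := by
  have h := IsLeftFaithfullyFlat.exact_of_exact.{x, x, max x w, max u v} hA.2
    (0 : M →ₗ[(ρ.coinvariants)ᵐᵒᵖ] M) (unitMapRight (M := M) ρ.coinvariants) (by
      rw [BalTensor.rTensor_zero, LinearMap.exact_zero_iff_injective]
      exact rTensor_unitMapRight_injective ρ.coinvariants M)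
  rw [LinearMap.exact_zero_iff_injective] at h
  exact h

theorem exists_unitMap_eq_of_coinvariant
    (hA : ComoduleAlgebra.IsFaithfullyFlatGalois.{max u v w x} ρ) {p : BalTensor k ρ.coinvariants M A}
    (hp : inducedCoact ρ M p = p ⊗ₜ 1) : ∃ m, unitMap ρ.coinvariants M m = p := by
  have h := IsLeftFaithfullyFlat.exact_of_exact.{x, max x w, max x w v, u} hA.2
    (unitMapRight (M := M) ρ.coinvariants) (coinvariantDefect ρ M)
    (exact_rTensor_unitMapRight_coinvariantDefect hA.1)
  exact (h p).1 (by rw [coinvariantDefect_apply, hp, sub_self])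

end Descent

section Cofree

variable {k H M : Type*} [CommRing k] [Ring H] [HopfAlgebra k H] [AddCommGroup M] [Module k M]

theorem comulRight_tmul (m : M) (h : H) :
    comulRight k H M (m ⊗ₜ h) = (TensorProduct.assoc k M H H).symm (m ⊗ₜ Coalgebra.comul h) := by
  simp [comulRight, RightCoaction.cofree]

theorem coeff_counit_rTensor_comulRight (w : M ⊗[k] H) :
    (coeff (Coalgebra.counit (R := k) (A := H))).rTensor H (comulRight k H M w) = w := by
  induction w with
  | zero => simp
  | add a b ha hb => simp only [map_add, ha, hb]
  | tmul m h =>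
    have e : ∀ z : H ⊗[k] H, (coeff (Coalgebra.counit (R := k) (A := H))).rTensor H
        ((TensorProduct.assoc k M H H).symm (m ⊗ₜ z)) =
        m ⊗ₜ TensorProduct.lid k H ((Coalgebra.counit (R := k) (A := H)).rTensor H z) := by
      intro z
      induction z with
      | zero => simp
      | add a b ha hb => simp only [TensorProduct.tmul_add, map_add, ha, hb]
      | tmul a b => simp [coeff_tmul, TensorProduct.smul_tmul']
    rw [comulRight_tmul, e, Coalgebra.rTensor_counit_comul]
    simp

end Cofree

section CleftOfStable

variable {k H A : Type*} [CommRing k] [Ring H] [HopfAlgebra k H] [Module.Projective k H]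
  [Ring A] [Algebra k A] {ρ : ComoduleAlgebra k H A}
  {M : Type*} [AddCommGroup M] [Module k M] [Module (ρ.coinvariants)ᵐᵒᵖ M]
  [IsScalarTower k (ρ.coinvariants)ᵐᵒᵖ M]

/-- An `H`-stable module over a Hopf-Galois extension has a cleft rational endomorphism algebra:
with `φ = (M ⊗ ε) e⁻¹`, the map `t(h)(m ⊗ a) = φ(m ⊗ l(h)) ⊗ r(h) a` has the convolution inverse
`u(h)(m ⊗ a) = e(m ⊗ S(h)) a`. -/
theorem isCleft_of_isStable (hS : Function.Bijective (HopfAlgebra.antipode k (A := H)))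
    (hcan : Function.Bijective ρ.can) (hM : IsStable ρ M) :
    (endComoduleAlgebra A (RightCoaction.induced ρ M)).IsCleft := by
  obtain ⟨e, heB, heC⟩ := hM
  set P := BalTensor k ρ.coinvariants M A with hP
  have heC' : ∀ w, inducedCoact ρ M (e w) = e.toLinearMap.rTensor H (comulRight k H M w) :=
    LinearMap.congr_fun heC
  let φ : P →ₗ[k] M := coeff (Coalgebra.counit (R := k) (A := H)) ∘ₗ e.symm.toLinearMap
  have hφe : φ ∘ₗ e.toLinearMap = coeff (Coalgebra.counit (R := k) (A := H)) := by
    ext m h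
    simp [φ]
  have hφB : ∀ (b : ρ.coinvariants) (p : P), φ (op (b : A) • p) = op b • φ p := by
    intro b p
    obtain ⟨w, rfl⟩ := e.surjective p
    rw [← heB]
    have h1 := fun w => LinearMap.congr_fun hφe w
    simp only [LinearMap.comp_apply, LinearEquiv.coe_coe] at h1
    rw [h1, h1]
    induction w with
    | zero => simp
    | add a b ha hb => simp only [smul_add, map_add, ha, hb]
    | tmul m h => rw [TensorProduct.smul_tmul', coeff_tmul, coeff_tmul, smul_comm]
  have heφ : ∀ p : P, e (φ.rTensor H (inducedCoact ρ M p)) = p := by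
    intro p
    obtain ⟨w, rfl⟩ := e.surjective p
    rw [heC', ← LinearMap.rTensor_comp_apply, hφe, coeff_counit_rTensor_comulRight]
  let Θ : M →ₗ[k] A →ₗ[k] M :=
    ((TensorProduct.mk k M A).compr₂ (BalTensor.proj k ρ.coinvariants M A)).compr₂ φ
  have hΘ0 : ∀ m x, Θ m x = φ (BalTensor.proj k ρ.coinvariants M A (m ⊗ₜ x)) := fun _ _ => rfl
  have hΘ : ∀ (m : M) (x : A) (b : ρ.coinvariants), Θ m (x * b) = op b • Θ m x := by
    intro m x b
    rw [hΘ0, hΘ0, ← hφB, induced_smul_proj]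
  let W := balancedFamily ρ.coinvariants Θ hΘ
  let Gt : H →ₗ[k] M →ₗ[k] P := W.flip ∘ₗ translation hcan
  have hGt0 : ∀ h m, Gt h m = W m (translation hcan h) := fun _ _ => rfl
  let T : H →ₗ[k] Module.End Aᵐᵒᵖ P := inducedLift Gt fun h b m => by
    rw [hGt0, hGt0, ← balancedFamily_smul, ← leftMul_translation hcan b h]
    refine balancedFamily_leftMul _ _ _ _ (fun x => ?_) _
    rw [hΘ0, hΘ0, BalTensor.proj_balanced, Subalgebra.smul_def, smul_eq_mul]
  have hT1 : ∀ h m, T h (unitMap ρ.coinvariants M m) = W m (translation hcan h) :=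
    inducedLift_unitMap _ _
  have hT2 : ∀ h m a, T h (BalTensor.proj k ρ.coinvariants M A (m ⊗ₜ a)) =
    op a • W m (translation hcan h) := inducedLift_proj _ _
  let Gv : H →ₗ[k] M →ₗ[k] P := (TensorProduct.mk k M H).flip.compr₂ e.toLinearMap
  have hGv0 : ∀ h m, Gv h m = e (m ⊗ₜ h) := fun _ _ => rfl
  let V : H →ₗ[k] Module.End Aᵐᵒᵖ P := inducedLift Gv fun h b m => by
    rw [hGv0, hGv0, ← heB, TensorProduct.smul_tmul']
  have hV1 : ∀ h m, V h (unitMap ρ.coinvariants M m) = e (m ⊗ₜ h) := inducedLift_unitMap _ _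
  have hV2 : ∀ h m a, V h (BalTensor.proj k ρ.coinvariants M A (m ⊗ₜ a)) =
    op a • e (m ⊗ₜ h) := inducedLift_proj _ _
  have hWcoact : ∀ m z, inducedCoact ρ M (W m z) = (W m).rTensor H (inducedCoact ρ A z) := by
    intro m z
    induction z using induction_proj with
    | h0 => simp
    | hadd x y hx hy => simp only [map_add, hx, hy]
    | h x y =>
      rw [balancedFamily_proj, inducedCoact_proj, inducedCoact_proj,
        ← LinearMap.rTensor_comp_apply]
      rfl
  have hTval : ∀ h, IsCoactionValue (RightCoaction.induced ρ M) (T h)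
      (T.rTensor H (Coalgebra.comul h)) := by
    intro h
    refine isCoactionValue_of_unitMap ρ fun m => ?_
    rw [hT1, hWcoact, inducedCoact_translation, tensorEval_rTensor,
      ← LinearMap.rTensor_comp_apply]
    congr 2
    ext g
    exact (hT1 g m).symm
  have hVval : ∀ h, IsCoactionValue (RightCoaction.induced ρ M) (V h)
      (V.rTensor H (Coalgebra.comul h)) := by
    intro h
    refine isCoactionValue_of_unitMap ρ fun m => ?_
    rw [hV1, heC', tensorEval_rTensor, comulRight_tmul]
    generalize (Coalgebra.comul h : H ⊗[k] H) = z
    induction z with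
    | zero => simp
    | add a b ha hb => simp only [TensorProduct.tmul_add, map_add, ha, hb]
    | tmul a b => simp [endEval_tmul, hV1]
  obtain ⟨t, ht⟩ := exists_toEnd_eq T hTval
  obtain ⟨v, hv⟩ := exists_toEnd_eq V hVval
  let u := v ∘ₗ HopfAlgebra.antipode k
  let U := V ∘ₗ HopfAlgebra.antipode k
  have hu : toEnd (RightCoaction.induced ρ M) u = U :=
    congrArg (fun G => G ∘ₗ HopfAlgebra.antipode k) hv
  have hTφ : ∀ p, endEval (T ∘ₗ antipodeInv k H hS) (inducedCoact ρ M p) =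
      unitMap ρ.coinvariants M (φ p) := by
    intro p
    induction p using induction_proj with
    | h0 => simp
    | hadd x y hx hy => simp only [map_add, hx, hy]
    | h m a =>
      rw [inducedCoact_proj]
      exact translation_antipodeInv_coact hcan hS (endEval (T ∘ₗ antipodeInv k H hS) ∘ₗ
        (BalTensor.proj k ρ.coinvariants M A ∘ₗ TensorProduct.mk k M A m).rTensor H) (W m)
        (fun a h => by
          rw [balancedFamily_smul]
          exact hT2 _ _ _) a
  have hJ : ∀ m z, endEval V ((W m).rTensor H (leftFactorCoact ρ z)) =
      BalTensor.proj k ρ.coinvariants M A (m ⊗ₜ balMul ρ.coinvariants z) := by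
    intro m z
    induction z using induction_proj with
    | h0 => simp
    | hadd x y hx hy => simp only [TensorProduct.tmul_add, map_add, hx, hy]
    | h x y =>
      rw [balMul_proj, ← induced_smul_proj, ← heφ (BalTensor.proj k ρ.coinvariants M A (m ⊗ₜ x)),
        leftFactorCoact_proj, inducedCoact_proj]
      generalize ρ.coact x = z
      induction z with
      | zero => simp
      | add a b ha hb => simp only [map_add, smul_add, ha, hb]
      | tmul a h => exact hV2 h (Θ m a) y
  have ext_compEval : ∀ (G G' : H →ₗ[k] Module.End Aᵐᵒᵖ P),
      (∀ h m, compEval G G' (unitMap ρ.coinvariants M m) (Coalgebra.comul h) =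
        Coalgebra.counit (R := k) h • unitMap ρ.coinvariants M m) →
      ∀ h p, compEval G G' p (Coalgebra.comul h) = Coalgebra.counit (R := k) h • p := by
    intro G G' hG h p
    have := induced_hom_ext (f := LinearMap.mul' k (Module.End Aᵐᵒᵖ P)
      (TensorProduct.map G G' (Coalgebra.comul h)))
      (g := Coalgebra.counit (R := k) h • (LinearMap.id : P →ₗ[Aᵐᵒᵖ] P)) (hG h)
    exact LinearMap.congr_fun this p
  have htu : WithConv.toConv t * WithConv.toConv u = 1 := by
    rw [rationalEnd_convMul_eq_one_iff, ht, hu]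
    refine ext_compEval T U fun h m => ?_
    have h1 := hTφ (e (m ⊗ₜ HopfAlgebra.antipode k h))
    have h2 := LinearMap.congr_fun hφe (m ⊗ₜ HopfAlgebra.antipode k h)
    simp only [LinearMap.comp_apply, LinearEquiv.coe_coe] at h2
    rw [h2, coeff_tmul, HopfAlgebra.counit_antipode, map_smul, heC', comulRight_tmul,
      comul_antipode] at h1
    rw [← h1]
    generalize (Coalgebra.comul h : H ⊗[k] H) = z
    induction z with
    | zero => simp
    | add a b ha hb => simp only [TensorProduct.tmul_add, map_add, ha, hb]
    | tmul a b => simp [endEval_tmul, compEval_tmul, antipodeInv_antipode, U, hV1]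
  have hut : WithConv.toConv u * WithConv.toConv t = 1 := by
    rw [rationalEnd_convMul_eq_one_iff, ht, hu]
    refine ext_compEval U T fun h m => ?_
    have h1 := hJ m (translation hcan h)
    rw [balMul_translation, leftFactorCoact_translation, Algebra.algebraMap_eq_smul_one,
      TensorProduct.tmul_smul, map_smul, ← unitMap_apply] at h1
    rw [← h1]
    generalize (Coalgebra.comul h : H ⊗[k] H) = z
    induction z with
    | zero => simp
    | add a b ha hb => simp only [map_add, ha, hb]
    | tmul a b => simp [endEval_tmul, compEval_tmul, U, hT1]
  exact ⟨t, (isColinear_rationalEnd_iff t).2 (by rw [ht]; exact hTval),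
    ⟨⟨WithConv.toConv t, WithConv.toConv u, htu, hut⟩, rfl⟩⟩

end CleftOfStable

section StableOfCleft

/-- For a colinear map `t` to `END_A(P)`, the element `t(S⁻¹(p₁))(p₀)` of `P` is coinvariant. -/
theorem coact_endEval_antipodeInv {k H A P : Type*} [CommRing k] [Ring H] [HopfAlgebra k H]
    [Ring A] [Algebra k A] [AddCommGroup P] [Module k P] [Module Aᵐᵒᵖ P] [IsScalarTower k Aᵐᵒᵖ P]
    (δ : RightCoaction k H P) (hS : Function.Bijective (HopfAlgebra.antipode k (A := H)))
    {T : H →ₗ[k] Module.End Aᵐᵒᵖ P}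
    (hT : ∀ h, IsCoactionValue δ (T h) (T.rTensor H (Coalgebra.comul h))) (p : P) :
    δ.coact (endEval (T ∘ₗ antipodeInv k H hS) (δ.coact p)) =
      endEval (T ∘ₗ antipodeInv k H hS) (δ.coact p) ⊗ₜ 1 := by
  set c : H ⊗[k] H →ₗ[k] H := LinearMap.mul' k H ∘ₗ (antipodeInv k H hS).rTensor H ∘ₗ
    (TensorProduct.comm k H H).toLinearMap with hc
  have e : ∀ w : P ⊗[k] H, δ.coact (endEval (T ∘ₗ antipodeInv k H hS) w) =
      (endEval (T ∘ₗ antipodeInv k H hS)).rTensor H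
        (midContract c (TensorProduct.map δ.coact Coalgebra.comul w)) := by
    intro w
    induction w with
    | zero => simp
    | add a b ha hb => simp only [map_add, ha, hb]
    | tmul p h =>
      rw [endEval_tmul, LinearMap.comp_apply, hT, comul_antipodeInv, TensorProduct.map_tmul]
      generalize (Coalgebra.comul h : H ⊗[k] H) = z
      generalize δ.coact p = w
      induction z with
      | zero => simp
      | add a b ha hb =>
        simp only [TensorProduct.tmul_add, map_add, LinearMap.add_apply, ha, hb]
      | tmul a b =>
        induction w with
        | zero => simp
        | add a b ha hb => simp only [TensorProduct.add_tmul, map_add, ha, hb]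
        | tmul q y => simp [tensorAct_tmul, midContract_tmul, endEval_tmul, c]
  rw [e, midContract_coact δ c (mul_antipodeInv_comm_comul hS), LinearMap.rTensor_tmul]

variable {k : Type u} {H : Type v} {A : Type w} {M : Type x}
  [CommRing k] [Ring H] [HopfAlgebra k H] [Module.Projective k H]
  [Ring A] [Algebra k A] {ρ : ComoduleAlgebra k H A}
  [AddCommGroup M] [Module k M] [Module (ρ.coinvariants)ᵐᵒᵖ M]
  [IsScalarTower k (ρ.coinvariants)ᵐᵒᵖ M]

/-- A module over a faithfully flat Hopf-Galois extension is `H`-stable if its rational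
endomorphism algebra is cleft: if `t` is colinear with convolution inverse `u`, then
`m ⊗ h ↦ u(S⁻¹(h))(m ⊗ 1)` is an isomorphism. -/
theorem isStable_of_isCleft (hS : Function.Bijective (HopfAlgebra.antipode k (A := H)))
    (hA : ComoduleAlgebra.IsFaithfullyFlatGalois.{max u v w x} ρ)
    (hE : (endComoduleAlgebra A (RightCoaction.induced ρ M)).IsCleft) : IsStable ρ M := by
  obtain ⟨t, htc, ⟨⟨t', u', htu, hut⟩, rfl : t' = _⟩⟩ := hE
  obtain ⟨u, rfl⟩ : ∃ u, WithConv.toConv u = u' := ⟨u'.ofConv, rfl⟩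
  have hvc := isColinear_convInverse_antipodeInv hS _ htc htu hut
  rw [isColinear_rationalEnd_iff] at htc hvc
  rw [rationalEnd_convMul_eq_one_iff] at htu hut
  have hVU : toEnd (RightCoaction.induced ρ M) (u ∘ₗ antipodeInv k H hS) =
    toEnd _ u ∘ₗ antipodeInv k H hS := rfl
  rw [hVU] at hvc
  revert htc hvc htu hut
  generalize toEnd _ t = T
  generalize toEnd _ u = U
  intro htc htu hut hvc
  set δ := RightCoaction.induced ρ M with hδ
  set P := BalTensor k ρ.coinvariants M A with hP
  set V := U ∘ₗ antipodeInv k H hS with hV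
  let i := unitMap ρ.coinvariants M
  let e : M ⊗[k] H →ₗ[k] P := endEval V ∘ₗ i.rTensor H
  have he : ∀ m h, e (m ⊗ₜ h) = V h (i m) := fun _ _ => rfl
  have hec : ∀ w, inducedCoact ρ M (e w) = e.rTensor H (comulRight k H M w) := by
    intro w
    induction w with
    | zero => simp
    | add a b ha hb => simp only [map_add, ha, hb]
    | tmul m h =>
      have h1 : inducedCoact ρ M (V h (i m)) = _ := hvc h (i m)
      have h2 : δ.coact (i m) = i m ⊗ₜ 1 := inducedCoact_unitMap ρ m
      rw [he, h1, h2, tensorAct_tmul_one, tensorEval_rTensor, comulRight_tmul]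
      generalize (Coalgebra.comul h : H ⊗[k] H) = z
      induction z with
      | zero => simp
      | add a b ha hb => simp only [TensorProduct.tmul_add, map_add, ha, hb]
      | tmul a b => simp [endEval_tmul, he]
  have hi : Function.Injective i := unitMap_injective_of_faithfullyFlat hA
  have hrange : ∀ p, endEval (T ∘ₗ antipodeInv k H hS) (δ.coact p) ∈ LinearMap.range i :=
    fun p => exists_unitMap_eq_of_coinvariant hA (coact_endEval_antipodeInv δ hS htc p)
  let φ : P →ₗ[k] M := (LinearEquiv.ofInjective i hi).symm.toLinearMap ∘ₗ
    LinearMap.codRestrict (LinearMap.range i)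
      (endEval (T ∘ₗ antipodeInv k H hS) ∘ₗ δ.coact) hrange
  have hφ : i ∘ₗ φ = endEval (T ∘ₗ antipodeInv k H hS) ∘ₗ δ.coact := by
    ext1 p
    exact congrArg Subtype.val ((LinearEquiv.ofInjective i hi).apply_symm_apply
      ⟨_, hrange p⟩)
  have hφe : φ ∘ₗ e = coeff (Coalgebra.counit (R := k) (A := H)) := by
    ext m g
    obtain ⟨h, rfl⟩ := hS.2 g
    apply hi
    have h1 := LinearMap.congr_fun hφ (e (m ⊗ₜ HopfAlgebra.antipode k h))
    have h2 : δ.coact (e (m ⊗ₜ HopfAlgebra.antipode k h)) = _ := hec _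
    simp only [LinearMap.comp_apply] at h1
    change i (φ (e (m ⊗ₜ HopfAlgebra.antipode k h))) = i (coeff Coalgebra.counit
      (m ⊗ₜ HopfAlgebra.antipode k h))
    rw [h1, h2, coeff_tmul, HopfAlgebra.counit_antipode, map_smul, ← htu h (i m), comulRight_tmul,
      comul_antipode]
    generalize (Coalgebra.comul h : H ⊗[k] H) = z
    induction z with
    | zero => simp
    | add a b ha hb => simp only [TensorProduct.tmul_add, map_add, ha, hb]
    | tmul a b => simp [endEval_tmul, compEval_tmul, antipodeInv_antipode, V, he]
  have hcomp : ∀ w : P ⊗[k] H, endEval V ((endEval (T ∘ₗ antipodeInv k H hS)).rTensor H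
      (comulRight k H P w)) = coeff (Coalgebra.counit (R := k) (A := H)) w := by
    intro w
    induction w with
    | zero => simp
    | add a b ha hb => simp only [map_add, ha, hb]
    | tmul p g =>
      obtain ⟨h, rfl⟩ := hS.2 g
      rw [coeff_tmul, HopfAlgebra.counit_antipode, ← hut h p, comulRight_tmul, comul_antipode]
      generalize (Coalgebra.comul h : H ⊗[k] H) = z
      induction z with
      | zero => simp
      | add a b ha hb => simp only [TensorProduct.tmul_add, map_add, ha, hb]
      | tmul a b => simp [endEval_tmul, compEval_tmul, antipodeInv_antipode, V]
  let e' : P →ₗ[k] M ⊗[k] H := φ.rTensor H ∘ₗ inducedCoact ρ M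
  have hee' : e ∘ₗ e' = LinearMap.id := by
    ext1 p
    have h1 : e (e' p) = endEval V (i.rTensor H (φ.rTensor H (δ.coact p))) := rfl
    rw [LinearMap.comp_apply, h1, ← LinearMap.rTensor_comp_apply, hφ,
      LinearMap.rTensor_comp_apply, ← comulRight_coact, hcomp]
    exact LinearMap.congr_fun δ.counit p
  have he'e : e' ∘ₗ e = LinearMap.id := by
    ext1
    ext1 m
    ext1 h
    have h1 : e' (e (m ⊗ₜ h)) = φ.rTensor H (inducedCoact ρ M (e (m ⊗ₜ h))) := rfl
    change e' (e (m ⊗ₜ h)) = m ⊗ₜ h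
    rw [h1, hec, ← LinearMap.rTensor_comp_apply, hφe, coeff_counit_rTensor_comulRight]
  refine ⟨LinearEquiv.ofLinearMap e e' hee' he'e, fun b z => ?_, LinearMap.ext hec⟩
  change e (op b • z) = op (b : A) • e z
  induction z with
  | zero => simp
  | add a b ha hb => simp only [smul_add, map_add, ha, hb]
  | tmul m h => rw [TensorProduct.smul_tmul', he, he, ← map_smul, ← unitMap_smul]

end StableOfCleft

end HopfGalois

end

theorem proposition6p1 {k : Type u} {H : Type v} {A : Type w} {M : Type x}
    [CommRing k] [Ring H] [HopfAlgebra k H] [Module.Projective k H]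
    (hS : Function.Bijective (HopfAlgebra.antipode k (A := H)))
    [Ring A] [Algebra k A] (ρ : HopfGalois.ComoduleAlgebra k H A)
    (hA : HopfGalois.ComoduleAlgebra.IsFaithfullyFlatGalois.{max u v w x} ρ)
    [AddCommGroup M] [Module k M] [Module (ρ.coinvariants)ᵐᵒᵖ M]
    [IsScalarTower k (ρ.coinvariants)ᵐᵒᵖ M] :
    HopfGalois.IsStable ρ M ↔
      (HopfGalois.endComoduleAlgebra A (HopfGalois.RightCoaction.induced ρ M)).IsCleft :=
  ⟨HopfGalois.isCleft_of_isStable hS hA.1, HopfGalois.isStable_of_isCleft hS hA⟩
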